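/- A quiver $Q$ consists of a finite non-empty set of vertices $Q_0$, a finite set of arrows $Q_1$, and source and target maps $s,t\colon Q_1\to Q_0$. A representation $(V,\rho)$ of $Q$ over $\mathbb{C}$ consists of finite-dimensional complex vector spaces $V_a$ ($a\in Q_0$) and linear maps $\rho_\alpha\colon V_{s(\alpha)}\to V_{t(\alpha)}$ ($\alpha\in Q_1$). For a weight $\theta\in\mathbb{R}^{Q_0}$ and a non-zero representation put $$\mu_\theta(V,\rho)=\frac{\sum_{a\in Q_0}\theta_a\dim V_a}{\sum_{a\in Q_0}\dim V_a}.$$ A non-zero representation $(V,\rho)$ is $\theta$-semistable (respectively $\theta$-stable) if $\mu_\theta(S)\le\mu_\theta(V,\rho)$ (respectively $\mu_\theta(S)<\mu_\theta(V,\rho)$) for every non-zero proper subrepresentation $S$ of $(V,\rho)$. It is $\theta$-polystable if it is $\theta$-semistable and is isomorphic to a direct sum of a finite family of $\theta$-stable representations of $Q$, each having the same slope $\mu_\theta$ as $(V,\rho)$. Given quivers $Q$ and $Q'$, the internal product $Q\otimes Q'$ is the quiver with vertex set $Q_0\times Q_0'$ and arrow set $(Q_0\times Q_1')\sqcup(Q_1\times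 Q_0')$, where $(a,\alpha')$ goes from $(a,s(\alpha'))$ to $(a,t(\alpha'))$ and $(\alpha,a')$ goes from $(s(\alpha),a')$ to $(t(\alpha),a')$. The tensor product $(V,\rho)\otimes(W,\sigma)$ of a representation $(V,\rho)$ of $Q$ and a representation $(W,\sigma)$ of $Q'$ is the representation of $Q\otimes Q'$ with the space $V_a\otimes W_{a'}$ at $(a,a')$, the map $\mathrm{id}_{V_a}\otimes\sigma_{\alpha'}$ on the arrow $(a,\alpha')$, and the map $\rho_\alpha\otimes\mathrm{id}_{W_{a'}}$ on the arrow $(\alpha,a')$. **Lemma.** Let $\theta$ and $\theta'$ be rational weights of $Q$ and $Q'$ (that is, all their components are rational numbers), and let $\overline\theta=(\theta_a+\theta'_{a'})_{(a,a')\in Q_0\times Q_0'}$. Suppose that the representation $(V,\rho)$ of $Q$ over $\mathbb{C}$ is $\theta$-polystable and that the representation $(W,\sigma)$ of $Q'$ over $\mathbb{C}$ is $\theta'$-polystable. Then the representation $(V,\rho)\otimes(W,\sigma)$ of $Q\otimes Q'$ is $\overline\theta$-polystable. -/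

import Mathlib

open scoped TensorProduct DirectSum

noncomputable section

universe u u' v v' w w' x

/-- A finite-dimensional representation of a quiver `Q` over a field `k`. -/
structure QuiverRep (k : Type x) [Field k] (Q : Type u) [Quiver.{v} Q] where
  /-- the vector space at a vertex -/
  space : Q → Type w
  [addCommGroup : ∀ a, AddCommGroup (space a)]
  [module : ∀ a, Module k (space a)]
  [finite : ∀ a, FiniteDimensional k (space a)]
  /-- the linear map of an arrow -/
  map : ∀ {a b : Q}, (a ⟶ b) → (space a →ₗ[k] space b)

namespace QuiverRep

attribute [instance] QuiverRep.addCommGroup QuiverRep.module QuiverRep.finite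

variable {k : Type x} [Field k] {Q : Type u} [Quiver.{v} Q]

/-- An isomorphism of representations: isomorphisms at all vertices which commute with
the maps of all arrows. -/
structure Iso (V : QuiverRep.{u, v, w, x} k Q) (W : QuiverRep.{u, v, w', x} k Q) where
  equiv : ∀ a, V.space a ≃ₗ[k] W.space a
  comm : ∀ {a b : Q} (α : a ⟶ b),
    W.map α ∘ₗ (equiv a).toLinearMap = (equiv b).toLinearMap ∘ₗ V.map α

/-- A subrepresentation: a family of subspaces preserved by the maps of all arrows. -/
structure Subrep (V : QuiverRep.{u, v, w, x} k Q) where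
  carrier : ∀ a, Submodule k (V.space a)
  map_mem : ∀ {a b : Q} (α : a ⟶ b), ∀ y ∈ carrier a, V.map α y ∈ carrier b

/-- A subrepresentation, as a representation with the restricted maps. -/
def Subrep.toRep {V : QuiverRep.{u, v, w, x} k Q} (S : V.Subrep) :
    QuiverRep.{u, v, w, x} k Q where
  space a := S.carrier a
  map α := (V.map α).restrict (S.map_mem α)

/-- A subrepresentation is proper if it is not the whole representation. -/
def Subrep.IsProper {V : QuiverRep.{u, v, w, x} k Q} (S : V.Subrep) : Prop :=
  ∃ a, S.carrier a ≠ ⊤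

/-- The representation is non-zero. -/
def IsNonzero (V : QuiverRep.{u, v, w, x} k Q) : Prop := ∃ a, Nontrivial (V.space a)

/-- The direct sum of a finite family of representations. -/
def directSum {ι : Type} [Finite ι] (R : ι → QuiverRep.{u, v, w, x} k Q) :
    QuiverRep.{u, v, w, x} k Q where
  space a := ⨁ i, (R i).space a
  finite a := by
    classical
    have := Fintype.ofFinite ι
    exact Module.Finite.equiv
      (DirectSum.linearEquivFunOnFintype k ι (fun i => (R i).space a)).symm
  map α := DirectSum.lmap fun i => (R i).map α

section Slope

variable [Fintype Q]

/-- The rank: the sum of the dimensions at all vertices. -/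
def rank (V : QuiverRep.{u, v, w, x} k Q) : ℕ := ∑ a, Module.finrank k (V.space a)

/-- The degree with respect to a weight `θ ∈ ℝ^Q`. -/
def degree (θ : Q → ℝ) (V : QuiverRep.{u, v, w, x} k Q) : ℝ :=
  ∑ a, θ a * (Module.finrank k (V.space a) : ℝ)

/-- The slope: degree divided by rank (meaningful for non-zero representations). -/
def slope (θ : Q → ℝ) (V : QuiverRep.{u, v, w, x} k Q) : ℝ := V.degree θ / (V.rank : ℝ)

/-- `θ`-semistability. -/
def IsSemistable (θ : Q → ℝ) (V : QuiverRep.{u, v, w, x} k Q) : Prop :=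
  V.IsNonzero ∧ ∀ S : V.Subrep, S.toRep.IsNonzero → S.IsProper → S.toRep.slope θ ≤ V.slope θ

/-- `θ`-stability. -/
def IsStable (θ : Q → ℝ) (V : QuiverRep.{u, v, w, x} k Q) : Prop :=
  V.IsNonzero ∧ ∀ S : V.Subrep, S.toRep.IsNonzero → S.IsProper → S.toRep.slope θ < V.slope θ

/-- `θ`-polystability: semistable, and (isomorphic to) a direct sum of a finite family of
`θ`-stable representations, each of the same slope as the given representation. -/
def IsPolystable (θ : Q → ℝ) (V : QuiverRep.{u, v, w, x} k Q) : Prop :=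
  V.IsSemistable θ ∧
    ∃ (n : ℕ) (R : Fin n → QuiverRep.{u, v, w, x} k Q),
      (∀ i, (R i).IsStable θ ∧ (R i).slope θ = V.slope θ) ∧
        Nonempty (Iso V (directSum R))

end Slope

end QuiverRep

/-- The vertices of the internal product of two quivers: pairs of vertices. (A type synonym
of the product, so as not to interfere with any other quiver structure on it.) -/
def InternalProduct (Q : Type u) (Q' : Type u') : Type (max u u') := Q × Q'

instance InternalProduct.instFintype {Q : Type u} {Q' : Type u'} [Fintype Q] [Fintype Q'] :
    Fintype (InternalProduct Q Q') :=
  inferInstanceAs (Fintype (Q × Q'))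

/-- The arrows of the internal product: a pair `(α, c)` of an arrow `α : a ⟶ b` of `Q` and a
vertex `c` of `Q'` is an arrow from `(a, c)` to `(b, c)`, a pair `(a, β)` of a vertex `a` of `Q`
and an arrow `β : c ⟶ d` of `Q'` is an arrow from `(a, c)` to `(a, d)`, and these are all. -/
inductive InternalProduct.Arrow {Q : Type u} [Quiver.{v} Q] {Q' : Type u'} [Quiver.{v'} Q'] :
    InternalProduct Q Q' → InternalProduct Q Q' → Type (max u u' v v')
  | left {a b : Q} (α : a ⟶ b) (c : Q') : Arrow (a, c) (b, c)
  | right (a : Q) {c d : Q'} (β : c ⟶ d) : Arrow (a, c) (a, d)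

instance InternalProduct.instQuiver {Q : Type u} [Quiver.{v} Q] {Q' : Type u'} [Quiver.{v'} Q'] :
    Quiver.{max u u' v v'} (InternalProduct Q Q') where
  Hom := InternalProduct.Arrow

/-- The weight `(θ_a + θ'_c)_{(a, c)}` of the internal product. -/
def sumWeight {Q : Type u} {Q' : Type u'} (θ : Q → ℝ) (θ' : Q' → ℝ) :
    InternalProduct Q Q' → ℝ :=
  fun p => θ p.1 + θ' p.2

/-- A weight is rational if all its components are rational numbers. -/
def IsRationalWeight {Q : Type u} (θ : Q → ℝ) : Prop := ∀ a, ∃ q : ℚ, θ a = (q : ℝ)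

/-- The tensor product of a representation of `Q` and a representation of `Q'`, a
representation of the internal product, with maps `ρ_α ⊗ id` and `id ⊗ σ_β`. -/
def QuiverRep.tensor {k : Type x} [Field k] {Q : Type u} [Quiver.{v} Q]
    {Q' : Type u'} [Quiver.{v'} Q']
    (V : QuiverRep.{u, v, w, x} k Q) (W : QuiverRep.{u', v', w', x} k Q') :
    QuiverRep.{max u u', max u u' v v', max w w', x} k (InternalProduct Q Q') where
  space p := V.space p.1 ⊗[k] W.space p.2
  map γ :=
    match γ with
    | .left α c => TensorProduct.map (V.map α) (LinearMap.id : W.space c →ₗ[k] W.space c)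
    | .right a β => TensorProduct.map (LinearMap.id : V.space a →ₗ[k] V.space a) (W.map β)

end

/-! The proof goes through Hermitian metrics, as in the Kempf–Ness theorem and King's criterion.
Bases at the vertices, taken as orthonormal, amount to a metric. With `τ = θ - μ_θ(V)`, the metric
is harmonic if at every vertex the sum of `M Mᴴ` over incoming arrows minus the sum of `Mᴴ M` over
outgoing arrows equals `-τ`.

Harmonicity passes to tensor products at once. Each arrow of the internal product moves only one
coordinate, so the moment map of the tensor product is `μ ⊗ 1 + 1 ⊗ μ'`, and the constants `τ`, `τ'`
add (`HasHarmonicMetric.tensor`). What remains is that a nonzero representation is polystable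
exactly when it has a harmonic metric.

From metric to polystability: pairing the equation with the orthogonal projections onto a
subrepresentation `S` writes `-deg S` as a sum of squared norms. Hence `deg S ≤ 0`, and in case of
equality the orthogonal complement is again a subrepresentation. Induction on the rank then splits
off stable summands.

From polystability to metric: orthogonal direct sums reduce this to a stable representation. There
the Kempf–Ness functional is minimised over all changes of basis, and a minimum solves the equation
(`exists_momentMap_eq_of_isMin`). A minimum exists because, in every exponential direction, either
an exponential term blows up or the weights filter the representation by subrepresentations, whose
negative degrees make the linear term grow. -/

noncomputable section

/-! ### The moment map, and degrees of subrepresentations under a harmonic metric -/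

section

open Module Matrix

section MomentMap

variable {Q : Type u} [Quiver.{v} Q] [Fintype Q] [∀ a b : Q, Fintype (a ⟶ b)]
  {ι : Q → Type w} [∀ a, Fintype (ι a)]

/-- The moment map of a family of complex matrices indexed by the arrows of a quiver. -/
def momentMap (M : ∀ a b : Q, (a ⟶ b) → Matrix (ι b) (ι a) ℂ) (a : Q) : Matrix (ι a) (ι a) ℂ :=
  (∑ c, ∑ α : c ⟶ a, M c a α * (M c a α)ᴴ) - ∑ c, ∑ α : a ⟶ c, (M a c α)ᴴ * M a c α

/-- Each arrow is counted once at its head and once at its tail. The identity is used with `X` the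
identity (total degree), orthogonal projections (degree of a subrepresentation) and real diagonal
matrices (derivative of the Kempf–Ness functional). -/
theorem sum_trace_mul_momentMap (M : ∀ a b : Q, (a ⟶ b) → Matrix (ι b) (ι a) ℂ)
    (X : ∀ a, Matrix (ι a) (ι a) ℂ) :
    ∑ a, (X a * momentMap M a).trace =
      ∑ a, ∑ b, ∑ α : a ⟶ b, ((X b * (M a b α * (M a b α)ᴴ)).trace -
        (X a * ((M a b α)ᴴ * M a b α)).trace) := by
  simp only [momentMap, Matrix.mul_sub, Matrix.trace_sub, Finset.sum_sub_distrib, Matrix.mul_sum,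
    Matrix.trace_sum]
  congr 1
  exact Finset.sum_comm

theorem momentMap_isHermitian (M : ∀ a b : Q, (a ⟶ b) → Matrix (ι b) (ι a) ℂ) (a : Q) :
    (momentMap M a).IsHermitian := by
  simp [Matrix.IsHermitian, momentMap, Matrix.conjTranspose_sum]

end MomentMap

/-- The squared Frobenius norm of a complex matrix. -/
def Matrix.frobSq {m : Type*} {n : Type*} [Fintype m] [Fintype n] (X : Matrix m n ℂ) : ℝ :=
  ∑ i, ∑ j, ‖X i j‖ ^ 2

section FrobSq

variable {m : Type*} {n : Type*} [Fintype m] [Fintype n]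

theorem Matrix.trace_mul_conjTranspose_eq_frobSq (X : Matrix m n ℂ) :
    (X * Xᴴ).trace = (X.frobSq : ℂ) := by
  simp [Matrix.trace, Matrix.mul_apply, Matrix.frobSq, Complex.mul_conj, Complex.normSq_eq_norm_sq]

theorem Matrix.frobSq_nonneg (X : Matrix m n ℂ) : 0 ≤ X.frobSq := by
  unfold Matrix.frobSq; positivity

theorem Matrix.frobSq_eq_zero {X : Matrix m n ℂ} (h : X.frobSq = 0) : X = 0 := by
  unfold Matrix.frobSq at h
  ext i j
  rw [Finset.sum_eq_zero_iff_of_nonneg (fun i _ => by positivity)] at h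
  have h1 := h i (Finset.mem_univ _)
  rw [Finset.sum_eq_zero_iff_of_nonneg (fun i _ => by positivity)] at h1
  simpa using h1 j (Finset.mem_univ _)

end FrobSq

theorem Module.Basis.exists_orthogonal_projection_matrix {ι : Type*} [Fintype ι] [DecidableEq ι]
    {E : Type*} [AddCommGroup E] [Module ℂ E] (b : Basis ι ℂ E) (S : Submodule ℂ E) :
    ∃ P : Matrix ι ι ℂ, P * P = P ∧ Pᴴ = P ∧ P.trace = (finrank ℂ S : ℂ) ∧
      ∀ x, x ∈ S ↔ P *ᵥ (b.repr x) = b.repr x := by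
  let e : E ≃ₗ[ℂ] EuclideanSpace ℂ ι := b.equivFun.trans (WithLp.linearEquiv 2 ℂ (ι → ℂ)).symm
  let T : Submodule ℂ (EuclideanSpace ℂ ι) := S.map e.toLinearMap
  let B := EuclideanSpace.basisFun ι ℂ
  let p : EuclideanSpace ℂ ι →ₗ[ℂ] EuclideanSpace ℂ ι := T.starProjection.toLinearMap
  have hp : LinearMap.IsProj T p := by
    refine ⟨fun x => ?_, fun x hx => ?_⟩
    · exact Submodule.starProjection_apply_mem T x
    · exact Submodule.starProjection_eq_self_iff.2 hx
  refine ⟨LinearMap.toMatrix B.toBasis B.toBasis p, ?_, ?_, ?_, ?_⟩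
  · rw [← LinearMap.toMatrix_mul]
    congr 1
    ext1 x
    exact hp.map_id _ (hp.map_mem x)
  · rw [← LinearMap.toMatrix_adjoint]
    congr 1
    have h2 : LinearMap.IsSymmetric p := Submodule.starProjection_isSymmetric T
    exact (LinearMap.isSymmetric_iff_isSelfAdjoint p).1 h2
  · have h1 := hp.trace
    rw [LinearMap.trace_eq_matrix_trace ℂ B.toBasis] at h1
    rw [h1, LinearEquiv.finrank_map_eq]
  · intro x
    have h1 : (b.repr x : ι → ℂ) = B.toBasis.repr (e x) := by
      ext i
      simp [B, e]
    rw [h1, LinearMap.toMatrix_mulVec_repr, DFunLike.coe_fn_eq, EmbeddingLike.apply_eq_iff_eq]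
    have h2 : p (e x) = e x ↔ e x ∈ T := Submodule.starProjection_eq_self_iff
    rw [h2]
    simp [T]

/-- Pythagoras: the left side is `‖R M‖² - ‖M P‖²`, and `M P = R M P` because `M` carries the image
of `P` into that of `R`. What is left is the block of `M` from the orthogonal complement into the
subspace. -/
theorem Matrix.trace_compl_projection {m : Type*} {n : Type*} [Fintype m] [Fintype n]
    [DecidableEq m] [DecidableEq n]
    {P : Matrix n n ℂ} {R : Matrix m m ℂ} (hP : P * P = P) (hP' : Pᴴ = P) (hR : R * R = R)
    (hR' : Rᴴ = R) (M : Matrix m n ℂ) (hM : R * M * P = M * P) :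
    (R * (M * Mᴴ)).trace - (P * (Mᴴ * M)).trace = ((R * M * (1 - P)).frobSq : ℂ) := by
  rw [← Matrix.trace_mul_conjTranspose_eq_frobSq]
  have hc : (1 - P)ᴴ = 1 - P := by simp [hP']
  have h1 : R * M * (1 - P) * (R * M * (1 - P))ᴴ = (R * M * Mᴴ) * R - (M * P) * Mᴴ * R := by
    have : (1 - P) * (1 - P) = 1 - P := by
      simp [Matrix.mul_sub, Matrix.sub_mul, hP]
    rw [Matrix.conjTranspose_mul, Matrix.conjTranspose_mul, hc, hR', ← Matrix.mul_assoc,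
      Matrix.mul_assoc (R * M), this, Matrix.mul_sub, hM, Matrix.mul_one]
    simp only [Matrix.sub_mul, Matrix.mul_assoc]
  have h2 : R * (M * P) = M * P := by rw [← Matrix.mul_assoc, hM]
  rw [h1, Matrix.trace_sub]
  congr 1
  · rw [Matrix.trace_mul_comm _ R]
    simp only [← Matrix.mul_assoc, hR]
  · rw [Matrix.trace_mul_comm _ R, ← Matrix.mul_assoc R, h2, Matrix.trace_mul_comm P,
      Matrix.mul_assoc, Matrix.trace_mul_comm]

namespace QuiverRep

variable {Q : Type u} [Quiver.{v} Q]

/-- The matrix of the map of an arrow, with respect to bases of the spaces at the vertices. -/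
def mat {k : Type x} [Field k] (V : QuiverRep.{u, v, w, x} k Q) {ι : Q → Type w'}
    [∀ a, Fintype (ι a)] [∀ a, DecidableEq (ι a)]
    (b : ∀ a, Basis (ι a) k (V.space a)) (a c : Q) (α : a ⟶ c) : Matrix (ι c) (ι a) k :=
  LinearMap.toMatrix (b a) (b c) (V.map α)

variable [Fintype Q] [∀ a b : Q, Fintype (a ⟶ b)]

/-- A representation has a harmonic metric of weight `τ` if there are bases of its spaces with
respect to which its matrices satisfy the moment map equation. -/
def HasHarmonicMetric (τ : Q → ℝ) (V : QuiverRep.{u, v, w, 0} ℂ Q) : Prop :=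
  ∃ (ι : Q → Type) (_ : ∀ a, Fintype (ι a)) (_ : ∀ a, DecidableEq (ι a))
    (b : ∀ a, Basis (ι a) ℂ (V.space a)), ∀ a, momentMap (V.mat b) a = -((τ a : ℂ) • 1)

/-- The degree of a subrepresentation. -/
def Subrep.deg {k : Type x} [Field k] {V : QuiverRep.{u, v, w, x} k Q} (τ : Q → ℝ)
    (S : V.Subrep) : ℝ :=
  ∑ a, τ a * (finrank k (S.carrier a) : ℝ)

theorem HasHarmonicMetric.degree_eq_zero {τ : Q → ℝ} {V : QuiverRep.{u, v, w, 0} ℂ Q}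
    (h : V.HasHarmonicMetric τ) : V.degree τ = 0 := by
  obtain ⟨ι, _, _, b, hb⟩ := h
  have h1 := sum_trace_mul_momentMap (V.mat b) (fun a => 1)
  simp only [hb, Matrix.one_mul] at h1
  have h2 : ∀ a, Matrix.trace (-((τ a : ℂ) • (1 : Matrix (ι a) (ι a) ℂ))) =
      ((-(τ a * (finrank ℂ (V.space a) : ℝ)) : ℝ) : ℂ) := by
    intro a
    simp [finrank_eq_card_basis (b a)]
  simp only [h2] at h1
  rw [← Complex.ofReal_sum] at h1
  have h3 : ∀ (a c : Q) (α : a ⟶ c), (V.mat b a c α * (V.mat b a c α)ᴴ).trace -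
      ((V.mat b a c α)ᴴ * V.mat b a c α).trace = 0 := fun a c α => by
    rw [Matrix.trace_mul_comm, sub_self]
  simp only [h3, Finset.sum_const_zero] at h1
  have h4 : ∑ a, -(τ a * (finrank ℂ (V.space a) : ℝ)) = 0 := by exact_mod_cast h1
  rw [Finset.sum_neg_distrib, neg_eq_zero] at h4
  exact h4

/-- Pairing the moment map with the orthogonal projections `P a` onto `S` gives `-deg S = ∑ ‖P M (1
- P)‖²`. If this vanishes, no arrow maps the orthogonal complement back into `S`, so the complement
is invariant. -/
theorem HasHarmonicMetric.deg_nonpos_and_exists_isCompl {τ : Q → ℝ} {V : QuiverRep.{u, v, w, 0} ℂ Q}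
    (h : V.HasHarmonicMetric τ) (S : V.Subrep) :
    S.deg τ ≤ 0 ∧
      (S.deg τ = 0 → ∃ T : V.Subrep, ∀ a, IsCompl (S.carrier a) (T.carrier a)) := by
  obtain ⟨ι, _, _, b, hb⟩ := h
  choose P hPP hPs hPt hPm using fun a => (b a).exists_orthogonal_projection_matrix (S.carrier a)
  -- Invariance of `S` in matrix form, checked on the columns of `P a`, which are coordinates of
  -- vectors of `S`.
  have hinv : ∀ (a c : Q) (α : a ⟶ c), P c * V.mat b a c α * P a = V.mat b a c α * P a := by
    intro a c α
    rw [Matrix.mul_assoc]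
    apply Matrix.ext_of_mulVec_single
    intro j
    obtain ⟨x, hx⟩ : ∃ x, ((b a).repr x : ι a → ℂ) = P a *ᵥ (Pi.single j 1) :=
      ⟨(b a).equivFun.symm (P a *ᵥ (Pi.single j 1)), by
        rw [← Basis.equivFun_apply, LinearEquiv.apply_symm_apply]⟩
    have hxS : x ∈ S.carrier a := by
      rw [hPm, hx, Matrix.mulVec_mulVec, hPP]
    have h2 := (hPm c _).1 (S.map_mem α x hxS)
    have h3 : ((b c).repr (V.map α x) : ι c → ℂ) = V.mat b a c α *ᵥ ((b a).repr x) :=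
      (LinearMap.toMatrix_mulVec_repr (b a) (b c) (V.map α) x).symm
    rw [h3, hx] at h2
    simpa only [Matrix.mulVec_mulVec, Matrix.mul_assoc] using h2
  have h1 := sum_trace_mul_momentMap (V.mat b) P
  have h2 : ∀ a, Matrix.trace (P a * -((τ a : ℂ) • (1 : Matrix (ι a) (ι a) ℂ))) =
      ((-(τ a * (finrank ℂ (S.carrier a) : ℝ)) : ℝ) : ℂ) := by
    intro a
    simp [hPt]
  simp only [hb, h2] at h1
  simp only [fun (a c : Q) (α : a ⟶ c) => Matrix.trace_compl_projection (hPP a) (hPs a)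
    (hPP c) (hPs c) (V.mat b a c α) (hinv a c α), ← Complex.ofReal_sum] at h1
  have h4 := Complex.ofReal_injective h1
  rw [Finset.sum_neg_distrib] at h4
  change -(S.deg τ) = _ at h4
  have hnn : ∀ (a c : Q) (α : a ⟶ c), 0 ≤ (P c * V.mat b a c α * (1 - P a)).frobSq :=
    fun _ _ _ => Matrix.frobSq_nonneg _
  constructor
  · have : 0 ≤ -(S.deg τ) := by
      rw [h4]
      exact Finset.sum_nonneg fun a _ => Finset.sum_nonneg fun c _ =>
        Finset.sum_nonneg fun α _ => hnn a c α
    linarith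
  · intro hS
    rw [hS, neg_zero] at h4
    have h5 : ∀ (a c : Q) (α : a ⟶ c), P c * V.mat b a c α * (1 - P a) = 0 := by
      intro a c α
      apply Matrix.frobSq_eq_zero
      have := (Finset.sum_eq_zero_iff_of_nonneg (fun a _ => Finset.sum_nonneg fun c _ =>
        Finset.sum_nonneg fun α _ => hnn a c α)).1 h4.symm a (Finset.mem_univ _)
      have := (Finset.sum_eq_zero_iff_of_nonneg (fun c _ =>
        Finset.sum_nonneg fun α _ => hnn a c α)).1 this c (Finset.mem_univ _)
      exact (Finset.sum_eq_zero_iff_of_nonneg (fun α _ => hnn a c α)).1 this α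
        (Finset.mem_univ _)
    -- The complement is the kernel of the orthogonal projection.
    refine ⟨⟨fun a => LinearMap.ker ((P a).mulVecLin ∘ₗ (b a).equivFun.toLinearMap), ?_⟩, ?_⟩
    · intro a c α y hy
      have hy' : P a *ᵥ ((b a).repr y) = 0 := hy
      change P c *ᵥ ((b c).repr (V.map α y)) = 0
      have h3 : ((b c).repr (V.map α y) : ι c → ℂ) = V.mat b a c α *ᵥ ((b a).repr y) :=
        (LinearMap.toMatrix_mulVec_repr (b a) (b c) (V.map α) y).symm
      have h6 := h5 a c α
      rw [Matrix.mul_sub, Matrix.mul_one, sub_eq_zero] at h6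
      rw [h3, Matrix.mulVec_mulVec, h6, ← Matrix.mulVec_mulVec, hy', Matrix.mulVec_zero]
    · intro a
      rw [isCompl_iff, Submodule.disjoint_def, codisjoint_iff, eq_top_iff]
      constructor
      · intro x hx hx'
        have hx'' : P a *ᵥ ((b a).repr x) = 0 := hx'
        rw [hPm, hx''] at hx
        exact (b a).equivFun.injective (by rw [map_zero]; exact hx.symm)
      · intro x _
        obtain ⟨y, hy⟩ : ∃ y, ((b a).repr y : ι a → ℂ) = P a *ᵥ ((b a).repr x) :=
          ⟨(b a).equivFun.symm (P a *ᵥ ((b a).repr x)), by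
            rw [← Basis.equivFun_apply, LinearEquiv.apply_symm_apply]⟩
        refine Submodule.mem_sup.2 ⟨y, ?_, x - y, ?_, by abel⟩
        · rw [hPm, hy, Matrix.mulVec_mulVec, hPP]
        · change P a *ᵥ ((b a).equivFun (x - y)) = 0
          have hy' : (b a).equivFun y = P a *ᵥ ((b a).equivFun x) := hy
          rw [map_sub, hy', Matrix.mulVec_sub, Matrix.mulVec_mulVec, hPP, sub_self]

end QuiverRep

end

/-! ### Polystability from a harmonic metric -/

section

open Module

theorem iSupIndep_option {α : Type*} [CompleteLattice α] [IsModularLattice α] {ι : Type*}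
    {f : Option ι → α} (h : iSupIndep fun i => f (some i))
    (h0 : Disjoint (f none) (⨆ i, f (some i))) : iSupIndep f := by
  intro i
  cases i with
  | none =>
    refine h0.mono_right (iSup₂_le fun j hj => ?_)
    cases j with
    | none => exact absurd rfl hj
    | some j => exact le_iSup (fun i => f (some i)) j
  | some i =>
    have h1 : (⨆ (j) (_ : j ≠ some i), f j) ≤ (⨆ (j) (_ : j ≠ i), f (some j)) ⊔ f none := by
      refine iSup₂_le fun j hj => ?_
      cases j with
      | none => exact le_sup_right
      | some j =>
        exact le_trans (le_iSup₂_of_le (f := fun (j : ι) (_ : j ≠ i) => f (some j)) j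
          (fun e => hj (by rw [e])) le_rfl) le_sup_left
    refine Disjoint.mono_right h1 ?_
    refine (h i).disjoint_sup_right_of_disjoint_sup_left ?_
    refine h0.symm.mono_left (sup_le (le_iSup (fun i => f (some i)) i) ?_)
    exact iSup₂_le fun j _ => le_iSup (fun i => f (some i)) j

namespace QuiverRep

variable {k : Type x} [Field k] {Q : Type u} [Quiver.{v} Q] {V : QuiverRep.{u, v, w, x} k Q}

namespace Subrep

/-- The intersection of two subrepresentations. -/
def inter (S T : V.Subrep) : V.Subrep where
  carrier a := S.carrier a ⊓ T.carrier a
  map_mem α y hy := ⟨S.map_mem α y hy.1, T.map_mem α y hy.2⟩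

/-- A subrepresentation of a subrepresentation, as a subrepresentation of the ambient one. -/
def ofToRep {S : V.Subrep} (T : S.toRep.Subrep) : V.Subrep where
  carrier a := (T.carrier a).map (S.carrier a).subtype
  map_mem {a b} α y hy := by
    obtain ⟨z, hz, rfl⟩ := hy
    exact ⟨_, T.map_mem α z hz, rfl⟩

theorem ofToRep_le {S : V.Subrep} (T : S.toRep.Subrep) (a : Q) :
    (ofToRep T).carrier a ≤ S.carrier a :=
  Submodule.map_subtype_le _ _

theorem finrank_ofToRep {S : V.Subrep} (T : S.toRep.Subrep) (a : Q) :
    finrank k ((ofToRep T).carrier a) = finrank k (T.carrier a) :=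
  Submodule.finrank_map_subtype_eq (S.carrier a) (T.carrier a)

end Subrep

theorem nonempty_iso_directSum {n : ℕ} (T : Fin n → V.Subrep)
    (hT : ∀ a, DirectSum.IsInternal fun i => (T i).carrier a) :
    Nonempty (Iso V (directSum fun i => (T i).toRep)) := by
  let e : ∀ a, (⨁ i, (T i).carrier a) ≃ₗ[k] V.space a := fun a =>
    LinearEquiv.ofBijective (DirectSum.coeLinearMap fun i => (T i).carrier a) (hT a)
  refine ⟨⟨fun a => (e a).symm, ?_⟩⟩
  intro a b α
  have h : V.map α ∘ₗ (e a).toLinearMap =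
      (e b).toLinearMap ∘ₗ (directSum fun i => (T i).toRep).map α := by
    refine DirectSum.linearMap_ext _ fun i => ?_
    ext x
    change V.map α (DirectSum.coeLinearMap (fun i => (T i).carrier a)
      (DirectSum.lof k (Fin n) (fun i => (T i).carrier a) i x)) =
      DirectSum.coeLinearMap (fun i => (T i).carrier b) (DirectSum.lmap
        (fun i => (V.map α).restrict ((T i).map_mem α)) (DirectSum.lof k (Fin n) (fun i => (T i).carrier a) i x))
    rw [DirectSum.coeLinearMap_lof, DirectSum.lmap_lof]
    exact (DirectSum.coeLinearMap_lof (fun i => (T i).carrier b) i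
      ((V.map α).restrict ((T i).map_mem α) x)).symm
  ext x
  apply (e b).injective
  have h1 := LinearMap.congr_fun h ((e a).symm x)
  simp only [LinearMap.comp_apply, LinearEquiv.coe_coe, LinearEquiv.apply_symm_apply] at h1
  change e b _ = e b ((e b).symm _)
  rw [LinearEquiv.apply_symm_apply, h1]
  rfl

variable [Fintype Q]

theorem isNonzero_iff_rank_pos (V : QuiverRep.{u, v, w, x} k Q) : V.IsNonzero ↔ 0 < V.rank := by
  rw [rank, Finset.sum_pos_iff]
  simp only [Finset.mem_univ, true_and, Module.finrank_pos_iff]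
  rfl

theorem degree_sub_const (θ : Q → ℝ) (c : ℝ) (V : QuiverRep.{u, v, w, x} k Q) :
    V.degree (fun a => θ a - c) = V.degree θ - c * (V.rank : ℝ) := by
  simp [degree, rank, sub_mul, Finset.sum_sub_distrib, Finset.mul_sum]

/-- Shifting the weight by `c` trades the slope for a degree, which is additive in dimensions. -/
theorem slope_le_iff (θ : Q → ℝ) (c : ℝ) {V : QuiverRep.{u, v, w, x} k Q} (hV : V.IsNonzero) :
    V.slope θ ≤ c ↔ V.degree (fun a => θ a - c) ≤ 0 := by
  have h : (0 : ℝ) < V.rank := by exact_mod_cast (isNonzero_iff_rank_pos V).1 hV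
  rw [degree_sub_const, slope, div_le_iff₀ h, sub_nonpos]

theorem slope_lt_iff (θ : Q → ℝ) (c : ℝ) {V : QuiverRep.{u, v, w, x} k Q} (hV : V.IsNonzero) :
    V.slope θ < c ↔ V.degree (fun a => θ a - c) < 0 := by
  have h : (0 : ℝ) < V.rank := by exact_mod_cast (isNonzero_iff_rank_pos V).1 hV
  rw [degree_sub_const, slope, div_lt_iff₀ h, sub_neg]

theorem slope_eq_iff (θ : Q → ℝ) (c : ℝ) {V : QuiverRep.{u, v, w, x} k Q} (hV : V.IsNonzero) :
    V.slope θ = c ↔ V.degree (fun a => θ a - c) = 0 := by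
  have h : (0 : ℝ) < V.rank := by exact_mod_cast (isNonzero_iff_rank_pos V).1 hV
  rw [degree_sub_const, slope, div_eq_iff h.ne', sub_eq_zero]

theorem Subrep.degree_toRep (τ : Q → ℝ) (S : V.Subrep) : S.toRep.degree τ = S.deg τ := rfl

theorem Subrep.deg_ofToRep (τ : Q → ℝ) {S : V.Subrep} (T : S.toRep.Subrep) :
    (Subrep.ofToRep T).deg τ = T.deg τ := by
  simp [Subrep.deg, Subrep.finrank_ofToRep]

theorem Subrep.rank_ofToRep {S : V.Subrep} (T : S.toRep.Subrep) :
    (Subrep.ofToRep T).toRep.rank = T.toRep.rank :=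
  Finset.sum_congr rfl fun a _ => Subrep.finrank_ofToRep T a

theorem Subrep.rank_lt {S : V.Subrep} {T : S.toRep.Subrep} (hT : T.IsProper) :
    T.toRep.rank < S.toRep.rank := by
  obtain ⟨a, ha⟩ := hT
  refine Finset.sum_lt_sum (fun a _ => Submodule.finrank_le _) ⟨a, Finset.mem_univ _, ?_⟩
  exact Submodule.finrank_lt ha

/-- If `S` is not stable, a destabilising proper subrepresentation has degree at least `0`, hence
exactly `0` by `hss`, and smaller rank; so the descent ends at a stable one. -/
theorem Subrep.exists_isStable_le {τ : Q → ℝ} (hss : ∀ S : V.Subrep, S.deg τ ≤ 0) {θ : Q → ℝ}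
    {c : ℝ} (hτ : τ = fun a => θ a - c) (S : V.Subrep) (hS : S.deg τ = 0)
    (hS0 : S.toRep.IsNonzero) :
    ∃ T : V.Subrep, (∀ a, T.carrier a ≤ S.carrier a) ∧ T.deg τ = 0 ∧ T.toRep.IsStable θ ∧
      T.toRep.slope θ = c := by
  induction h : S.toRep.rank using Nat.strong_induction_on generalizing S with
  | _ n ih =>
    have hslope : S.toRep.slope θ = c := (slope_eq_iff θ c hS0).2 (hτ ▸ hS)
    by_cases hst : S.toRep.IsStable θ
    · exact ⟨S, fun a => le_rfl, hS, hst, hslope⟩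
    · simp only [IsStable, hS0, true_and, not_forall, hslope, not_lt] at hst
      obtain ⟨T, hT0, hTp, hT⟩ := hst
      rw [← not_lt, slope_lt_iff θ c hT0, ← hτ, not_lt, T.degree_toRep, ← Subrep.deg_ofToRep] at hT
      have hTd := le_antisymm (hss _) hT
      have hn0 : (Subrep.ofToRep T).toRep.IsNonzero := by
        rw [isNonzero_iff_rank_pos, Subrep.rank_ofToRep]
        exact (isNonzero_iff_rank_pos _).1 hT0
      obtain ⟨U, hU, hU'⟩ := ih _ (by rw [← h, Subrep.rank_ofToRep]; exact Subrep.rank_lt hTp)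
        (Subrep.ofToRep T) hTd hn0 rfl
      exact ⟨U, fun a => (hU a).trans (Subrep.ofToRep_le T a), hU'⟩

/-- A stable `T` of degree `0` inside `S` has a complement `U` in `V`, and the modular law gives `S
= T ⊕ (S ∩ U)`. By additivity `S ∩ U` again has degree `0`, and its rank is smaller. -/
theorem Subrep.exists_isStable_decomposition {τ : Q → ℝ} (hss : ∀ S : V.Subrep, S.deg τ ≤ 0)
    (hc : ∀ S : V.Subrep, S.deg τ = 0 → ∃ T : V.Subrep, ∀ a, IsCompl (S.carrier a) (T.carrier a))
    {θ : Q → ℝ} {c : ℝ} (hτ : τ = fun a => θ a - c) (S : V.Subrep) (hS : S.deg τ = 0) :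
    ∃ (ι : Type) (_ : Finite ι) (T : ι → V.Subrep),
      (∀ i, (T i).toRep.IsStable θ ∧ (T i).toRep.slope θ = c) ∧
      ∀ a, iSupIndep (fun i => (T i).carrier a) ∧ ⨆ i, (T i).carrier a = S.carrier a := by
  induction h : S.toRep.rank using Nat.strong_induction_on generalizing S with
  | _ n ih =>
    by_cases hS0 : S.toRep.IsNonzero
    · obtain ⟨T, hTS, hT, hTs, hTc⟩ := Subrep.exists_isStable_le hss hτ S hS hS0
      obtain ⟨U, hU⟩ := hc T hT
      have hdis : ∀ a, Disjoint (T.carrier a) ((S.inter U).carrier a) := fun a =>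
        (hU a).disjoint.mono_right inf_le_right
      have hsup : ∀ a, T.carrier a ⊔ (S.inter U).carrier a = S.carrier a := by
        intro a
        change T.carrier a ⊔ (S.carrier a ⊓ U.carrier a) = S.carrier a
        rw [inf_comm, ← sup_inf_assoc_of_le _ (hTS a), (hU a).sup_eq_top, top_inf_eq]
      have hdim : ∀ a, finrank k (S.carrier a) =
          finrank k (T.carrier a) + finrank k ((S.inter U).carrier a) := by
        intro a
        have := Submodule.finrank_sup_add_finrank_inf_eq (T.carrier a) ((S.inter U).carrier a)
        rw [hsup, (hdis a).eq_bot, finrank_bot, add_zero] at this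
        exact this
      have hdeg : (S.inter U).deg τ = 0 := by
        have : S.deg τ = T.deg τ + (S.inter U).deg τ := by
          simp only [Subrep.deg, hdim, Nat.cast_add, mul_add, Finset.sum_add_distrib]
        linarith
      have hrk : (S.inter U).toRep.rank < n := by
        have h1 : S.toRep.rank = T.toRep.rank + (S.inter U).toRep.rank := by
          rw [rank, rank, rank, ← Finset.sum_add_distrib]
          exact Finset.sum_congr rfl fun a _ => hdim a
        have := (isNonzero_iff_rank_pos _).1 hTs.1
        omega
      obtain ⟨ι, hι, R, hR, hR'⟩ := ih _ hrk (S.inter U) hdeg rfl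
      refine ⟨Option ι, inferInstance, fun i => i.elim T R, ?_, fun a => ⟨?_, ?_⟩⟩
      · rintro (_ | i)
        · exact ⟨hTs, hTc⟩
        · exact hR i
      · refine iSupIndep_option (hR' a).1 ?_
        change Disjoint (T.carrier a) (⨆ i, (R i).carrier a)
        rw [(hR' a).2]
        exact hdis a
      · rw [iSup_option]
        change T.carrier a ⊔ (⨆ i, (R i).carrier a) = _
        rw [(hR' a).2, hsup]
    · refine ⟨Empty, inferInstance, Empty.elim, fun i => i.elim, fun a => ⟨fun i => i.elim, ?_⟩⟩
      rw [iSup_of_empty]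
      by_contra hne
      exact hS0 ⟨a, Submodule.nontrivial_iff_ne_bot.2 (Ne.symm hne)⟩

theorem HasHarmonicMetric.slope_eq [∀ a b : Q, Fintype (a ⟶ b)] {θ : Q → ℝ} {c : ℝ}
    {V : QuiverRep.{u, v, w, 0} ℂ Q} (h : V.HasHarmonicMetric fun a => θ a - c)
    (hV : V.IsNonzero) : V.slope θ = c :=
  (slope_eq_iff θ c hV).2 h.degree_eq_zero

theorem HasHarmonicMetric.isPolystable [∀ a b : Q, Fintype (a ⟶ b)] {θ : Q → ℝ} {c : ℝ}
    {V : QuiverRep.{u, v, w, 0} ℂ Q} (h : V.HasHarmonicMetric fun a => θ a - c)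
    (hV : V.IsNonzero) : V.IsPolystable θ := by
  have hss := fun S => (h.deg_nonpos_and_exists_isCompl S).1
  refine ⟨⟨hV, fun S hS _ => ?_⟩, ?_⟩
  · rw [h.slope_eq hV, slope_le_iff θ c hS]
    exact hss S
  · let S : V.Subrep := ⟨fun a => ⊤, fun _ _ _ => trivial⟩
    have hS : S.deg (fun a => θ a - c) = 0 := by
      have := h.degree_eq_zero
      simpa [Subrep.deg, degree, S] using this
    obtain ⟨ι, _, T, hT, hT'⟩ := Subrep.exists_isStable_decomposition hss
      (fun S => (h.deg_nonpos_and_exists_isCompl S).2) rfl S hS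
    obtain ⟨n, ⟨e⟩⟩ := Finite.exists_equiv_fin ι
    refine ⟨n, fun i => (T (e.symm i)).toRep, fun i => ?_, ?_⟩
    · rw [h.slope_eq hV]
      exact hT _
    · refine nonempty_iso_directSum _ fun a => ?_
      refine DirectSum.isInternal_submodule_of_iSupIndep_of_iSup_eq_top ?_ ?_
      · exact (hT' a).1.comp e.symm.injective
      · rw [e.symm.iSup_comp (g := fun i => (T i).carrier a)]
        exact (hT' a).2

end QuiverRep

end

/-! ### Harmonic metrics on direct sums and tensor products -/

section

open Module Matrix

section DFinsuppBasis

variable {R : Type*} [Semiring R] {ι : Type*} {M : ι → Type*}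
  [∀ i, AddCommMonoid (M i)] [∀ i, Module R (M i)] {η : ι → Type*} (b : ∀ i, Basis (η i) R (M i))

theorem DFinsupp.basis_repr_apply (x : Π₀ i, M i) (i : ι) (p : η i) :
    (DFinsupp.basis b).repr x ⟨i, p⟩ = (b i).repr (x i) p :=
  rfl

theorem DFinsupp.basis_apply_same (i : ι) (p : η i) : DFinsupp.basis b ⟨i, p⟩ i = b i p := by
  apply (b i).repr.injective
  ext q
  rw [← DFinsupp.basis_repr_apply, Basis.repr_self, Basis.repr_self]
  classical simp [Finsupp.single_apply]

theorem DFinsupp.basis_apply_ne {i j : ι} (p : η i) (h : i ≠ j) :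
    DFinsupp.basis b ⟨i, p⟩ j = 0 := by
  apply (b j).repr.injective
  ext q
  rw [← DFinsupp.basis_repr_apply, Basis.repr_self]
  classical simp [h]

end DFinsuppBasis

namespace QuiverRep

section

variable {Q : Type u} [Quiver.{v} Q] [Fintype Q] [∀ a b : Q, Fintype (a ⟶ b)]

/-- Bases pulled back along the isomorphism give the same matrices. -/
theorem HasHarmonicMetric.of_iso {τ : Q → ℝ} {V : QuiverRep.{u, v, w, 0} ℂ Q}
    {W : QuiverRep.{u, v, w', 0} ℂ Q} (f : Iso V W) (h : W.HasHarmonicMetric τ) :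
    V.HasHarmonicMetric τ := by
  obtain ⟨ι, _, _, b, hb⟩ := h
  refine ⟨ι, inferInstance, inferInstance, fun a => (b a).map (f.equiv a).symm, fun a => ?_⟩
  rw [← hb a]
  congr 1
  ext c d α i j
  have h1 := LinearMap.congr_fun (f.comm α) ((f.equiv c).symm (b c j))
  simp only [LinearMap.comp_apply, LinearEquiv.coe_coe, LinearEquiv.apply_symm_apply] at h1
  simp only [mat, LinearMap.toMatrix_apply, Basis.map_apply, Basis.map_repr, LinearEquiv.symm_symm,
    LinearEquiv.trans_apply, h1]

theorem momentMap_blockDiagonal' {n : ℕ} {ι : Fin n → Q → Type} [∀ i a, Fintype (ι i a)]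
    [∀ i a, DecidableEq (ι i a)] (M : ∀ (i : Fin n) (a b : Q), (a ⟶ b) → Matrix (ι i b) (ι i a) ℂ)
    (a : Q) : momentMap (ι := fun a => Σ i, ι i a)
      (fun a b α => Matrix.blockDiagonal' fun i => M i a b α) a =
      Matrix.blockDiagonal' fun i => momentMap (M i) a := by
  have hs : ∀ {κ : Type v} (s : Finset κ) (f : κ → ∀ i, Matrix (ι i a) (ι i a) ℂ),
      ∑ x ∈ s, Matrix.blockDiagonal' (f x) = Matrix.blockDiagonal' (∑ x ∈ s, f x) := fun s f =>
    (map_sum (Matrix.blockDiagonal'AddMonoidHom (fun i => ι i a) (fun i => ι i a) ℂ) f s).symm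
  have hs' : ∀ (f : Q → ∀ i, Matrix (ι i a) (ι i a) ℂ),
      ∑ x, Matrix.blockDiagonal' (f x) = Matrix.blockDiagonal' (∑ x, f x) := fun f =>
    (map_sum (Matrix.blockDiagonal'AddMonoidHom (fun i => ι i a) (fun i => ι i a) ℂ) f _).symm
  simp only [momentMap, Matrix.blockDiagonal'_conjTranspose, ← Matrix.blockDiagonal'_mul, hs, hs']
  rw [← Matrix.blockDiagonal'_sub]
  congr 1
  ext1 i
  simp

/-- With the summands made mutually orthogonal all matrices are block diagonal, so the equation
holds block by block. A common `τ` is needed to get a scalar at each vertex. -/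
theorem HasHarmonicMetric.directSum {n : ℕ} {τ : Q → ℝ} {R : Fin n → QuiverRep.{u, v, w, 0} ℂ Q}
    (h : ∀ i, (R i).HasHarmonicMetric τ) : (directSum R).HasHarmonicMetric τ := by
  choose ι hf hd b hb using h
  refine ⟨fun a => Σ i, ι i a, inferInstance, inferInstance,
    fun a => DFinsupp.basis fun i => b i a, fun a => ?_⟩
  have key : (QuiverRep.directSum R).mat (ι := fun a => Σ i, ι i a)
      (fun a => DFinsupp.basis fun i => b i a) =
      fun a c α => Matrix.blockDiagonal' fun i => (R i).mat (b i) a c α := by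
    funext a c α
    ext ⟨i, p⟩ ⟨j, q⟩
    have h1 : (QuiverRep.directSum R).mat (ι := fun a => Σ i, ι i a)
        (fun a => DFinsupp.basis fun i => b i a) a c α ⟨i, p⟩ ⟨j, q⟩ =
        (b i c).repr ((R i).map α ((DFinsupp.basis fun i => b i a) ⟨j, q⟩ i)) p := by
      exact LinearMap.toMatrix_apply _ _ _ _ _
    rw [h1, Matrix.blockDiagonal'_apply]
    by_cases hij : i = j
    · subst hij
      rw [DFinsupp.basis_apply_same]
      simp [mat, LinearMap.toMatrix_apply]
    · rw [DFinsupp.basis_apply_ne _ _ (Ne.symm hij)]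
      simp [hij]
  rw [key, momentMap_blockDiagonal']
  simp only [hb]
  ext ⟨i, p⟩ ⟨j, q⟩
  by_cases hij : i = j
  · subst hij
    simp [Matrix.blockDiagonal'_apply, Matrix.one_apply]
  · simp [Matrix.blockDiagonal'_apply, hij]

end

section Tensor

variable {Q : Type u} [Quiver.{v} Q] {Q' : Type u'} [Quiver.{v'} Q']

/-- The arrows of the internal product with a given target. -/
def arrowsInEquiv (p : InternalProduct Q Q') :
    (Σ q : InternalProduct Q Q', q ⟶ p) ≃ (Σ b, b ⟶ p.1) ⊕ (Σ d, d ⟶ p.2) where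
  toFun γ := match p, γ with
    | _, ⟨_, .left (a := b) α _⟩ => .inl ⟨b, α⟩
    | _, ⟨_, .right _ (c := d) β⟩ => .inr ⟨d, β⟩
  invFun γ := match γ with
    | .inl ⟨b, α⟩ => ⟨(b, p.2), .left α p.2⟩
    | .inr ⟨d, β⟩ => ⟨(p.1, d), .right p.1 β⟩
  left_inv γ := by rcases γ with ⟨_, _ | _⟩ <;> rfl
  right_inv γ := by rcases γ with ⟨_, _⟩ | ⟨_, _⟩ <;> rfl

/-- The arrows of the internal product with a given source. -/
def arrowsOutEquiv (p : InternalProduct Q Q') :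
    (Σ q : InternalProduct Q Q', p ⟶ q) ≃ (Σ b, p.1 ⟶ b) ⊕ (Σ d, p.2 ⟶ d) where
  toFun γ := match p, γ with
    | _, ⟨_, .left (b := b) α _⟩ => .inl ⟨b, α⟩
    | _, ⟨_, .right _ (d := d) β⟩ => .inr ⟨d, β⟩
  invFun γ := match γ with
    | .inl ⟨b, α⟩ => ⟨(b, p.2), .left α p.2⟩
    | .inr ⟨d, β⟩ => ⟨(p.1, d), .right p.1 β⟩
  left_inv γ := by rcases γ with ⟨_, _ | _⟩ <;> rfl
  right_inv γ := by rcases γ with ⟨_, _⟩ | ⟨_, _⟩ <;> rfl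

variable [Fintype Q] [∀ a b : Q, Fintype (a ⟶ b)] [Fintype Q'] [∀ a b : Q', Fintype (a ⟶ b)]
  [∀ p q : InternalProduct Q Q', Fintype (p ⟶ q)]

theorem sum_arrowsIn {A : Type*} [AddCommMonoid A] (p : InternalProduct Q Q')
    (f : ∀ q : InternalProduct Q Q', (q ⟶ p) → A) :
    ∑ q, ∑ γ, f q γ = ∑ b, ∑ α : b ⟶ p.1, f (b, p.2) (.left α p.2) +
      ∑ d, ∑ β : d ⟶ p.2, f (p.1, d) (.right p.1 β) := by
  rw [← Fintype.sum_sigma' f, ← (arrowsInEquiv p).symm.sum_comp, Fintype.sum_sum_type,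
    Fintype.sum_sigma, Fintype.sum_sigma]
  rfl

theorem sum_arrowsOut {A : Type*} [AddCommMonoid A] (p : InternalProduct Q Q')
    (f : ∀ q : InternalProduct Q Q', (p ⟶ q) → A) :
    ∑ q, ∑ γ, f q γ = ∑ b, ∑ α : p.1 ⟶ b, f (b, p.2) (.left α p.2) +
      ∑ d, ∑ β : p.2 ⟶ d, f (p.1, d) (.right p.1 β) := by
  rw [← Fintype.sum_sigma' f, ← (arrowsOutEquiv p).symm.sum_comp, Fintype.sum_sum_type,
    Fintype.sum_sigma, Fintype.sum_sigma]
  rfl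

open scoped Kronecker in
-- An arrow at `p` comes either from `Q` or from `Q'`, and contributes `M Mᴴ ⊗ 1` or `1 ⊗ M' M'ᴴ`
-- when incoming, and likewise when outgoing; no mixed terms arise.
theorem momentMap_kronecker {ι : Q → Type*} {κ : Q' → Type*} [∀ a, Fintype (ι a)]
    [∀ c, Fintype (κ c)] [∀ a, DecidableEq (ι a)] [∀ c, DecidableEq (κ c)]
    (M : ∀ a b : Q, (a ⟶ b) → Matrix (ι b) (ι a) ℂ)
    (M' : ∀ a b : Q', (a ⟶ b) → Matrix (κ b) (κ a) ℂ)
    (N : ∀ p q : InternalProduct Q Q', (p ⟶ q) → Matrix (ι q.1 × κ q.2) (ι p.1 × κ p.2) ℂ)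
    (hl : ∀ (a b : Q) (α : a ⟶ b) (c : Q'), N (a, c) (b, c) (.left α c) = M a b α ⊗ₖ 1)
    (hr : ∀ (a : Q) (c d : Q') (β : c ⟶ d), N (a, c) (a, d) (.right a β) = 1 ⊗ₖ M' c d β)
    (p : InternalProduct Q Q') :
    momentMap (ι := fun p : InternalProduct Q Q' => ι p.1 × κ p.2) N p =
      momentMap M p.1 ⊗ₖ 1 + 1 ⊗ₖ momentMap M' p.2 := by
  have e1 := sum_arrowsIn p fun q γ => N q p γ * (N q p γ)ᴴ
  have e2 := sum_arrowsOut p fun q γ => (N p q γ)ᴴ * N p q γ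
  have hl₁ : ∀ (b : Q) (α : b ⟶ p.1), N (b, p.2) p (.left α p.2) = M b p.1 α ⊗ₖ 1 :=
    fun b α => hl b p.1 α p.2
  have hl₂ : ∀ (b : Q) (α : p.1 ⟶ b), N p (b, p.2) (.left α p.2) = M p.1 b α ⊗ₖ 1 :=
    fun b α => hl p.1 b α p.2
  have hr₁ : ∀ (d : Q') (β : d ⟶ p.2), N (p.1, d) p (.right p.1 β) = 1 ⊗ₖ M' d p.2 β :=
    fun d β => hr p.1 d p.2 β
  have hr₂ : ∀ (d : Q') (β : p.2 ⟶ d), N p (p.1, d) (.right p.1 β) = 1 ⊗ₖ M' p.2 d β :=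
    fun d β => hr p.1 p.2 d β
  refine (congrArg₂ (· - ·) e1 e2).trans ?_
  simp only [momentMap, hl₁, hl₂, hr₁, hr₂, Matrix.conjTranspose_kronecker,
    ← Matrix.mul_kronecker_mul, Matrix.conjTranspose_one, Matrix.mul_one]
  let f : Matrix (ι p.1) (ι p.1) ℂ →+ Matrix (ι p.1 × κ p.2) (ι p.1 × κ p.2) ℂ :=
    AddMonoidHom.mk' (fun X => X ⊗ₖ 1) fun X Y => Matrix.add_kronecker X Y 1
  let g : Matrix (κ p.2) (κ p.2) ℂ →+ Matrix (ι p.1 × κ p.2) (ι p.1 × κ p.2) ℂ :=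
    AddMonoidHom.mk' (fun X => 1 ⊗ₖ X) fun X Y => Matrix.kronecker_add 1 X Y
  have hf : ∀ X : Matrix (ι p.1) (ι p.1) ℂ, X ⊗ₖ (1 : Matrix (κ p.2) (κ p.2) ℂ) = f X :=
    fun _ => rfl
  have hg : ∀ X : Matrix (κ p.2) (κ p.2) ℂ, (1 : Matrix (ι p.1) (ι p.1) ℂ) ⊗ₖ X = g X :=
    fun _ => rfl
  simp only [hf, hg, map_sub, map_sum]
  abel

open scoped Kronecker in
theorem HasHarmonicMetric.tensor {τ : Q → ℝ} {τ' : Q' → ℝ} {V : QuiverRep.{u, v, w, 0} ℂ Q}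
    {W : QuiverRep.{u', v', w', 0} ℂ Q'} (hV : V.HasHarmonicMetric τ)
    (hW : W.HasHarmonicMetric τ') : (V.tensor W).HasHarmonicMetric (sumWeight τ τ') := by
  obtain ⟨ι, _, _, b, hb⟩ := hV
  obtain ⟨κ, _, _, b', hb'⟩ := hW
  refine ⟨fun p => ι p.1 × κ p.2, inferInstance, inferInstance,
    fun p => (b p.1).tensorProduct (b' p.2), fun p => ?_⟩
  refine (momentMap_kronecker (V.mat b) (W.mat b') _ ?_ ?_ p).trans ?_
  · intro a₁ a₂ α c
    rw [← LinearMap.toMatrix_id (b' c)]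
    exact TensorProduct.toMatrix_map (b a₁) (b' c) (b a₂) (b' c) (V.map α) LinearMap.id
  · intro a c₁ c₂ β
    rw [← LinearMap.toMatrix_id (b a)]
    exact TensorProduct.toMatrix_map (b a) (b' c₁) (b a) (b' c₂) LinearMap.id (W.map β)
  · rw [hb, hb']
    ext ⟨i, j⟩ ⟨i', j'⟩
    simp only [sumWeight, Matrix.add_apply, Matrix.kroneckerMap_apply, Matrix.neg_apply,
      Matrix.smul_apply, Matrix.one_apply, Prod.mk.injEq, smul_eq_mul, Complex.ofReal_add]
    split_ifs <;> simp_all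
    ring

end Tensor

end QuiverRep

end

/-! ### Abel summation and the singular value decomposition -/

section

open Module Matrix

/-- Abel summation: since `τ` has total `0`, the sum is a combination of sums of `τ` over strict
superlevel sets of `f`, all positive, weighted by the gaps between consecutive values. The induction
is on the number of values of `f`. -/
theorem sum_mul_pos_of_sum_sublevel_neg {J : Type*} [Fintype J] (τ f : J → ℝ)
    (h0 : ∑ j, τ j = 0)
    (h : ∀ c, (∃ j, f j ≤ c) → (∃ j, c < f j) → ∑ j with f j ≤ c, τ j < 0)
    (hf : ∃ i j, f i < f j) : 0 < ∑ j, τ j * f j := by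
  classical
  induction hn : (Finset.univ.image f).card using Nat.strong_induction_on generalizing f with
  | _ n ih =>
    obtain ⟨i₀, j₀, hij⟩ := hf
    obtain ⟨m, -, hm⟩ := Finset.exists_max_image Finset.univ f ⟨i₀, Finset.mem_univ _⟩
    obtain ⟨p, hp, hp'⟩ := Finset.exists_max_image (Finset.univ.filter fun j => f j < f m) f
      ⟨i₀, by simpa using hij.trans_le (hm j₀ (Finset.mem_univ _))⟩
    have hpm : f p < f m := by simpa using hp
    have hgap : ∀ j, f j < f m → f j ≤ f p := fun j hj => hp' j (by simpa using hj)
    have hpos : 0 < ∑ j with ¬ f j ≤ f p, τ j := by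
      have h1 := h (f p) ⟨p, le_rfl⟩ ⟨m, hpm⟩
      have h2 := Finset.sum_filter_add_sum_filter_not Finset.univ (fun j => f j ≤ f p) τ
      linarith
    -- `f m` is the largest value and `f p` the second largest; truncating at `f p` removes one
    -- value and costs the top gap times the top superlevel sum.
    have hdec : ∑ j, τ j * f j = ∑ j, τ j * min (f j) (f p) +
        (f m - f p) * ∑ j with ¬ f j ≤ f p, τ j := by
      rw [Finset.sum_filter, Finset.mul_sum, ← Finset.sum_add_distrib]
      refine Finset.sum_congr rfl fun j _ => ?_
      by_cases hj : f j ≤ f p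
      · simp [hj]
      · have h1 : f j = f m := le_antisymm (hm j (Finset.mem_univ _))
          (not_lt.1 fun h => hj (hgap j h))
        rw [min_eq_right (not_le.1 hj).le, if_pos hj, h1]
        ring
    have hmul := mul_pos (sub_pos.2 hpm) hpos
    rw [hdec]
    by_cases hc : ∃ i j, min (f i) (f p) < min (f j) (f p)
    · refine add_pos (ih _ ?_ (fun j => min (f j) (f p)) ?_ hc rfl) hmul
      · rw [← hn]
        apply Finset.card_lt_card
        rw [Finset.ssubset_iff_of_subset]
        · refine ⟨f m, by simp, ?_⟩
          simp only [Finset.mem_image, Finset.mem_univ, true_and, not_exists]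
          exact fun j hj => absurd (min_le_right (f j) (f p)) (by rw [hj]; exact not_le.2 hpm)
        · intro y hy
          simp only [Finset.mem_image, Finset.mem_univ, true_and] at hy ⊢
          obtain ⟨j, rfl⟩ := hy
          rcases min_choice (f j) (f p) with h | h
          · exact ⟨j, h.symm⟩
          · exact ⟨p, h.symm⟩
      · rintro c ⟨i, hi⟩ ⟨j, hj⟩
        have hcp : c < f p := hj.trans_le (min_le_right _ _)
        have : ∀ j, min (f j) (f p) ≤ c ↔ f j ≤ c := fun j => by
          rw [min_le_iff]
          exact ⟨fun h => h.resolve_right (not_le.2 hcp), Or.inl⟩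
        simp only [this] at hi ⊢
        exact h c ⟨i, hi⟩ ⟨j, hj.trans_le (min_le_left _ _)⟩
    · push Not at hc
      have : ∀ j, min (f j) (f p) = min (f p) (f p) := fun j => le_antisymm (hc _ _) (hc _ _)
      rw [Finset.sum_congr rfl fun j _ => by rw [this j], ← Finset.sum_mul, h0]
      linarith

theorem Matrix.frobSq_conjTranspose {m n : Type*} [Fintype m] [Fintype n] (X : Matrix m n ℂ) :
    Xᴴ.frobSq = X.frobSq := by
  unfold Matrix.frobSq
  rw [Finset.sum_comm]
  simp

theorem Matrix.frobSq_unitary_mul {m n : Type*} [Fintype m] [Fintype n] [DecidableEq m]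
    {U : Matrix m m ℂ} (hU : Uᴴ * U = 1) (X : Matrix m n ℂ) : (U * X).frobSq = X.frobSq := by
  have : ((U * X).frobSq : ℂ) = X.frobSq := by
    rw [← Matrix.trace_mul_conjTranspose_eq_frobSq, ← Matrix.trace_mul_conjTranspose_eq_frobSq,
      Matrix.conjTranspose_mul, Matrix.mul_assoc, Matrix.trace_mul_comm, Matrix.mul_assoc,
      Matrix.mul_assoc, hU, Matrix.mul_one]
  exact_mod_cast this

theorem Matrix.frobSq_mul_unitary {m n : Type*} [Fintype m] [Fintype n] [DecidableEq n]
    {U : Matrix n n ℂ} (hU : Uᴴ * U = 1) (X : Matrix m n ℂ) : (X * Uᴴ).frobSq = X.frobSq := by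
  rw [← Matrix.frobSq_conjTranspose, Matrix.conjTranspose_mul, Matrix.conjTranspose_conjTranspose,
    Matrix.frobSq_unitary_mul hU, Matrix.frobSq_conjTranspose]

theorem Matrix.norm_det_eq_one_of_unitary {n : Type*} [Fintype n] [DecidableEq n]
    {U : Matrix n n ℂ} (hU : Uᴴ * U = 1) : ‖U.det‖ = 1 := by
  have h := congrArg (fun X => ‖Matrix.det X‖) hU
  simp only [Matrix.det_mul, Matrix.det_conjTranspose, norm_mul, norm_star, Matrix.det_one,
    norm_one] at h
  nlinarith [norm_nonneg U.det]

/-- The diagonal matrix with entries `exp (l i)`, as a unit. -/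
def expDiag {n : Type*} [Fintype n] [DecidableEq n] (l : n → ℝ) : (Matrix n n ℂ)ˣ where
  val := Matrix.diagonal fun i => ((Real.exp (l i) : ℝ) : ℂ)
  inv := Matrix.diagonal fun i => ((Real.exp (-l i) : ℝ) : ℂ)
  val_inv := by
    rw [Matrix.diagonal_mul_diagonal, ← Matrix.diagonal_one]
    congr 1; ext1 i
    rw [← Complex.ofReal_mul, ← Real.exp_add]; simp
  inv_val := by
    rw [Matrix.diagonal_mul_diagonal, ← Matrix.diagonal_one]
    congr 1; ext1 i
    rw [← Complex.ofReal_mul, ← Real.exp_add]; simp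

theorem norm_det_expDiag {n : Type*} [Fintype n] [DecidableEq n] (l : n → ℝ) :
    ‖(expDiag l).val.det‖ = Real.exp (∑ i, l i) := by
  rw [expDiag, Matrix.det_diagonal, norm_prod, Real.exp_sum]
  refine Finset.prod_congr rfl fun i _ => ?_
  rw [Complex.norm_real, Real.norm_of_nonneg (Real.exp_pos _).le]

open scoped ComplexOrder in
/-- The singular value decomposition of an invertible complex matrix. -/
theorem Matrix.exists_unitary_expDiag_unitary {n : Type*} [Fintype n] [DecidableEq n]
    (g : (Matrix n n ℂ)ˣ) : ∃ (k U : (Matrix n n ℂ)ˣ) (l : n → ℝ), k.valᴴ * k.val = 1 ∧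
      U ∈ Set.range (Unitary.toUnits (R := Matrix n n ℂ)) ∧ g = k * (expDiag l * U) := by
  have hpd : (g.valᴴ * g.val).PosDef :=
    Matrix.PosDef.conjTranspose_mul_self _ (Matrix.mulVec_injective_of_isUnit g.isUnit)
  have hH := hpd.isHermitian
  let W := hH.eigenvectorUnitary
  have hspec : (W : Matrix n n ℂ)ᴴ * (g.valᴴ * g.val) * W =
      Matrix.diagonal fun i => ((hH.eigenvalues i : ℝ) : ℂ) := by
    have := hH.conjStarAlgAut_star_eigenvectorUnitary
    rw [Unitary.conjStarAlgAut_star_apply] at this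
    exact this
  -- The singular values are the square roots of the eigenvalues of `gᴴ g`, hence the half.
  let l : n → ℝ := fun i => Real.log (hH.eigenvalues i) / 2
  let U : (Matrix n n ℂ)ˣ := (Unitary.toUnits W)⁻¹
  refine ⟨g * (expDiag l * U)⁻¹, U, l, ?_, ⟨W⁻¹, map_inv _ _⟩, by group⟩
  have hU : (g * (expDiag l * U)⁻¹).val = g.val * W.val * (expDiag l).inv := by
    rw [_root_.mul_inv_rev, inv_inv, Units.val_mul, Units.val_mul, Matrix.mul_assoc,
      Unitary.val_toUnits_apply, ← Units.inv_eq_val_inv]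
  have hD : (expDiag l).invᴴ = (expDiag l).inv := by
    rw [expDiag, Matrix.diagonal_conjTranspose]
    congr 1; ext1 i
    simp only [Pi.star_apply, Complex.star_def, Complex.conj_ofReal]
  rw [hU, Matrix.conjTranspose_mul, Matrix.conjTranspose_mul, hD]
  have h1 : (expDiag l).inv * ((W.val)ᴴ * g.valᴴ) * (g.val * W.val * (expDiag l).inv) =
      (expDiag l).inv * (W.valᴴ * (g.valᴴ * g.val) * W.val) * (expDiag l).inv := by
    simp only [Matrix.mul_assoc]
  rw [h1, hspec, expDiag, Matrix.diagonal_mul_diagonal, Matrix.diagonal_mul_diagonal,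
    ← Matrix.diagonal_one]
  congr 1; ext1 i
  have hpos : 0 < hH.eigenvalues i := hpd.eigenvalues_pos i
  rw [← Complex.ofReal_mul, ← Complex.ofReal_mul, ← Complex.ofReal_one]
  congr 1
  have h2 : hH.eigenvalues i = Real.exp (2 * l i) := by
    rw [mul_div_cancel₀ _ two_ne_zero, Real.exp_log hpos]
  refine (congrArg (fun z => Real.exp (-l i) * z * Real.exp (-l i)) h2).trans ?_
  rw [← Real.exp_add, ← Real.exp_add, Real.exp_eq_one_iff]
  ring

end

/-! ### The Kempf–Ness functional and its minima -/

section

open Module Matrix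

section KempfNess

variable {Q : Type u} [Quiver.{v} Q] {ι : Q → Type w} [∀ a, Fintype (ι a)]
  [∀ a, DecidableEq (ι a)]

/-- The action of a family of invertible matrices on a matrix representation. -/
def gaugeAct (g : ∀ a, (Matrix (ι a) (ι a) ℂ)ˣ) (M : ∀ a b : Q, (a ⟶ b) → Matrix (ι b) (ι a) ℂ)
    (a b : Q) (α : a ⟶ b) : Matrix (ι b) (ι a) ℂ :=
  (g b).val * M a b α * (g a)⁻¹.val

theorem gaugeAct_mul (g h : ∀ a, (Matrix (ι a) (ι a) ℂ)ˣ)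
    (M : ∀ a b : Q, (a ⟶ b) → Matrix (ι b) (ι a) ℂ) :
    gaugeAct (g * h) M = gaugeAct g (gaugeAct h M) := by
  funext a b α
  simp only [gaugeAct, Pi.mul_apply, _root_.mul_inv_rev, Units.val_mul, Matrix.mul_assoc]

variable [Fintype Q] [∀ a b : Q, Fintype (a ⟶ b)]

/-- The Kempf–Ness functional of a matrix representation. -/
def kempfNess (τ : Q → ℝ) (M : ∀ a b : Q, (a ⟶ b) → Matrix (ι b) (ι a) ℂ)
    (g : ∀ a, (Matrix (ι a) (ι a) ℂ)ˣ) : ℝ :=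
  (∑ a, ∑ b, ∑ α : a ⟶ b, (gaugeAct g M a b α).frobSq) +
    2 * ∑ a, τ a * Real.log ‖(g a).val.det‖

/-- The Kempf–Ness functional along the diagonal directions. -/
def diagKempfNess (τ : Q → ℝ) (M : ∀ a b : Q, (a ⟶ b) → Matrix (ι b) (ι a) ℂ)
    (l : ∀ a, ι a → ℝ) : ℝ :=
  (∑ a, ∑ b, ∑ α : a ⟶ b, ∑ i, ∑ j, ‖M a b α i j‖ ^ 2 * Real.exp (2 * (l b i - l a j))) +
    2 * ∑ a, τ a * ∑ i, l a i

theorem inv_val_eq_conjTranspose {n : Type*} [Fintype n] [DecidableEq n] {k : (Matrix n n ℂ)ˣ}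
    (hk : k.valᴴ * k.val = 1) : k⁻¹.val = k.valᴴ :=
  Units.inv_eq_of_mul_eq_one_left hk

theorem kempfNess_unitary_mul (τ : Q → ℝ) (M : ∀ a b : Q, (a ⟶ b) → Matrix (ι b) (ι a) ℂ)
    {k : ∀ a, (Matrix (ι a) (ι a) ℂ)ˣ} (hk : ∀ a, (k a).valᴴ * (k a).val = 1)
    (g : ∀ a, (Matrix (ι a) (ι a) ℂ)ˣ) : kempfNess τ M (k * g) = kempfNess τ M g := by
  unfold kempfNess
  rw [gaugeAct_mul]
  refine congrArg₂ (· + ·) ?_ ?_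
  · refine Finset.sum_congr rfl fun a _ => Finset.sum_congr rfl fun b _ =>
      Finset.sum_congr rfl fun α _ => ?_
    rw [gaugeAct, inv_val_eq_conjTranspose (hk a), Matrix.frobSq_mul_unitary (hk a),
      Matrix.frobSq_unitary_mul (hk b)]
  · simp only [Pi.mul_apply, Units.val_mul, Matrix.det_mul, norm_mul,
      Matrix.norm_det_eq_one_of_unitary (hk _), one_mul]

theorem frobSq_expDiag {m n : Type*} [Fintype m] [Fintype n] [DecidableEq m] [DecidableEq n]
    (l : m → ℝ) (l' : n → ℝ) (X : Matrix m n ℂ) :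
    ((expDiag l).val * X * (expDiag l')⁻¹.val).frobSq =
      ∑ i, ∑ j, ‖X i j‖ ^ 2 * Real.exp (2 * (l i - l' j)) := by
  refine Finset.sum_congr rfl fun i _ => Finset.sum_congr rfl fun j _ => ?_
  change ‖(Matrix.diagonal (fun i => ((Real.exp (l i) : ℝ) : ℂ)) * X *
    Matrix.diagonal (fun j => ((Real.exp (-l' j) : ℝ) : ℂ))) i j‖ ^ 2 = _
  rw [Matrix.mul_diagonal, Matrix.diagonal_mul, norm_mul, norm_mul, Complex.norm_real,
    Complex.norm_real, Real.norm_of_nonneg (Real.exp_pos _).le,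
    Real.norm_of_nonneg (Real.exp_pos _).le, mul_pow, mul_pow, ← Real.exp_nat_mul,
    ← Real.exp_nat_mul, mul_comm (Real.exp _), mul_assoc, ← Real.exp_add]
  congr 2
  push_cast
  ring

/-- Moving the base point to `g` changes the functional only by a constant independent of `l`. -/
theorem kempfNess_expDiag_mul (τ : Q → ℝ) (M : ∀ a b : Q, (a ⟶ b) → Matrix (ι b) (ι a) ℂ)
    (l : ∀ a, ι a → ℝ) (g : ∀ a, (Matrix (ι a) (ι a) ℂ)ˣ) :
    kempfNess τ M ((fun a => expDiag (l a)) * g) =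
      diagKempfNess τ (gaugeAct g M) l + 2 * ∑ a, τ a * Real.log ‖(g a).val.det‖ := by
  have h1 : ∀ a, Real.log ‖(((fun a => expDiag (l a)) * g) a).val.det‖ =
      (∑ i, l a i) + Real.log ‖(g a).val.det‖ := by
    intro a
    have hg : ‖(g a).val.det‖ ≠ 0 := by
      rw [norm_ne_zero_iff]
      exact ((Matrix.isUnit_iff_isUnit_det _).1 (g a).isUnit).ne_zero
    rw [Pi.mul_apply, Units.val_mul, Matrix.det_mul, norm_mul, norm_det_expDiag,
      Real.log_mul (Real.exp_pos _).ne' hg, Real.log_exp]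
  unfold kempfNess diagKempfNess
  rw [gaugeAct_mul]
  simp only [h1, mul_add, Finset.sum_add_distrib, ← add_assoc]
  congr 2
  exact Finset.sum_congr rfl fun a _ => Finset.sum_congr rfl fun b _ =>
    Finset.sum_congr rfl fun α _ => frobSq_expDiag _ _ _

theorem sum_mul_momentMap_diag (M : ∀ a b : Q, (a ⟶ b) → Matrix (ι b) (ι a) ℂ)
    (l : ∀ a, ι a → ℝ) :
    ∑ a, ∑ i, (l a i : ℂ) * momentMap M a i i =
      ((∑ a, ∑ b, ∑ α : a ⟶ b, ∑ i, ∑ j, ‖M a b α i j‖ ^ 2 * (l b i - l a j) : ℝ) : ℂ) := by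
  have h1 := sum_trace_mul_momentMap M fun a => Matrix.diagonal fun i => (l a i : ℂ)
  have h2 : ∀ a (X : Matrix (ι a) (ι a) ℂ),
      (Matrix.diagonal (fun i => (l a i : ℂ)) * X).trace = ∑ i, (l a i : ℂ) * X i i := by
    intro a X
    simp [Matrix.trace]
  simp only [h2] at h1
  rw [h1]
  push_cast
  refine Finset.sum_congr rfl fun a _ => Finset.sum_congr rfl fun b _ =>
    Finset.sum_congr rfl fun α _ => ?_
  simp only [mul_sub, Finset.sum_sub_distrib]
  congr 1
  · refine Finset.sum_congr rfl fun i _ => ?_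
    rw [Matrix.mul_apply, Finset.mul_sum]
    refine Finset.sum_congr rfl fun j _ => ?_
    rw [Matrix.conjTranspose_apply, Complex.star_def, Complex.mul_conj, Complex.normSq_eq_norm_sq]
    push_cast
    ring
  · rw [Finset.sum_comm]
    refine Finset.sum_congr rfl fun i _ => ?_
    rw [Matrix.mul_apply, Finset.mul_sum]
    refine Finset.sum_congr rfl fun j _ => ?_
    rw [Matrix.conjTranspose_apply, Complex.star_def, mul_comm ((starRingEnd ℂ) _),
      Complex.mul_conj, Complex.normSq_eq_norm_sq]
    push_cast
    ring

-- By `sum_mul_momentMap_diag` this derivative is twice the pairing of `l` with the diagonal of `μ +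
-- τ`.
omit [∀ a, DecidableEq (ι a)] in
theorem hasDerivAt_diagKempfNess (τ : Q → ℝ) (M : ∀ a b : Q, (a ⟶ b) → Matrix (ι b) (ι a) ℂ)
    (l : ∀ a, ι a → ℝ) :
    HasDerivAt (fun t : ℝ => diagKempfNess τ M (t • l))
      (2 * (∑ a, ∑ b, ∑ α : a ⟶ b, ∑ i, ∑ j, ‖M a b α i j‖ ^ 2 * (l b i - l a j)) +
        2 * ∑ a, τ a * ∑ i, l a i) 0 := by
  unfold diagKempfNess
  have h2 : HasDerivAt (fun t : ℝ => 2 * ∑ a, τ a * ∑ i, (t • l) a i)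
      (2 * ∑ a, τ a * ∑ i, l a i) 0 := by
    have : (fun t : ℝ => 2 * ∑ a, τ a * ∑ i, (t • l) a i) =
        fun t => t * (2 * ∑ a, τ a * ∑ i, l a i) := by
      funext t
      simp only [Pi.smul_apply, smul_eq_mul, Finset.mul_sum]
      refine Finset.sum_congr rfl fun a _ => Finset.sum_congr rfl fun i _ => by ring
    rw [this]
    simpa using (hasDerivAt_id (0 : ℝ)).mul_const (2 * ∑ a, τ a * ∑ i, l a i)
  refine HasDerivAt.add ?_ h2
  rw [Finset.mul_sum]
  refine HasDerivAt.fun_sum fun a _ => ?_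
  rw [Finset.mul_sum]
  refine HasDerivAt.fun_sum fun b _ => ?_
  rw [Finset.mul_sum]
  refine HasDerivAt.fun_sum fun α _ => ?_
  rw [Finset.mul_sum]
  refine HasDerivAt.fun_sum fun i _ => ?_
  rw [Finset.mul_sum]
  refine HasDerivAt.fun_sum fun j _ => ?_
  have h3 : HasDerivAt (fun t : ℝ => 2 * ((t • l) b i - (t • l) a j)) (2 * (l b i - l a j)) 0 := by
    have : (fun t : ℝ => 2 * ((t • l) b i - (t • l) a j)) = fun t => t * (2 * (l b i - l a j)) := by
      funext t
      simp only [Pi.smul_apply, smul_eq_mul]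
      ring
    rw [this]
    simpa using (hasDerivAt_id (0 : ℝ)).mul_const (2 * (l b i - l a j))
  have h4 := (h3.exp).const_mul (‖M a b α i j‖ ^ 2)
  have h5 : ‖M a b α i j‖ ^ 2 * (Real.exp (2 * (((0 : ℝ) • l) b i - ((0 : ℝ) • l) a j)) *
      (2 * (l b i - l a j))) = 2 * (‖M a b α i j‖ ^ 2 * (l b i - l a j)) := by
    simp
    ring
  rw [← h5]
  exact h4

theorem momentMap_gaugeAct_unitary {k : ∀ a, (Matrix (ι a) (ι a) ℂ)ˣ}
    (hk : ∀ a, (k a).valᴴ * (k a).val = 1)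
    (M : ∀ a b : Q, (a ⟶ b) → Matrix (ι b) (ι a) ℂ) (a : Q) :
    momentMap (gaugeAct k M) a = (k a).val * momentMap M a * (k a).valᴴ := by
  have h1 : ∀ (a b : Q) (α : a ⟶ b), gaugeAct k M a b α = (k b).val * M a b α * (k a).valᴴ :=
    fun a b α => by rw [gaugeAct, inv_val_eq_conjTranspose (hk a)]
  simp only [momentMap, h1, Matrix.mul_sub, Matrix.sub_mul, Matrix.mul_sum, Matrix.sum_mul,
    Matrix.conjTranspose_mul, Matrix.conjTranspose_conjTranspose]
  have h2 : ∀ a b (X : Matrix (ι a) (ι b) ℂ), (k a).valᴴ * ((k a).val * X) = X := by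
    intro a b X
    rw [← Matrix.mul_assoc, hk, Matrix.one_mul]
  simp only [Matrix.mul_assoc, h2]

/-- A minimum of the Kempf–Ness functional yields a solution of the moment map equation. -/
theorem exists_momentMap_eq_of_isMin {τ : Q → ℝ}
    {M : ∀ a b : Q, (a ⟶ b) → Matrix (ι b) (ι a) ℂ} {g : ∀ a, (Matrix (ι a) (ι a) ℂ)ˣ}
    (hg : ∀ h, kempfNess τ M g ≤ kempfNess τ M h) :
    ∃ h : ∀ a, (Matrix (ι a) (ι a) ℂ)ˣ,
      ∀ a, momentMap (gaugeAct h M) a = -((τ a : ℂ) • 1) := by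
  have hH : ∀ a, (momentMap (gaugeAct g M) a + (τ a : ℂ) • 1).IsHermitian := fun a => by
    refine (momentMap_isHermitian _ a).add ?_
    simp [Matrix.IsHermitian, Matrix.conjTranspose_smul]
  -- A unitary change of basis, which does not affect the functional, makes `μ + τ` diagonal with
  -- real entries `l`. In the direction `l` itself the derivative is `2 ∑ l²`, so minimality forces
  -- `l = 0`.
  let k : ∀ a, (Matrix (ι a) (ι a) ℂ)ˣ := fun a => Unitary.toUnits (hH a).eigenvectorUnitary⁻¹
  let l : ∀ a, ι a → ℝ := fun a => (hH a).eigenvalues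
  have hk : ∀ a, (k a).valᴴ * (k a).val = 1 := fun a =>
    Unitary.star_mul_self_of_mem ((hH a).eigenvectorUnitary⁻¹).2
  have hk' : ∀ a, (k a).val * (k a).valᴴ = 1 := fun a =>
    Unitary.mul_star_self_of_mem ((hH a).eigenvectorUnitary⁻¹).2
  have hdiag : ∀ a, momentMap (gaugeAct (k * g) M) a =
      Matrix.diagonal (fun i => (l a i : ℂ)) - (τ a : ℂ) • 1 := by
    intro a
    have h1 := (hH a).conjStarAlgAut_star_eigenvectorUnitary
    rw [Unitary.conjStarAlgAut_star_apply] at h1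
    have h2 : (k a).val * (momentMap (gaugeAct g M) a + (τ a : ℂ) • 1) * (k a).valᴴ =
        Matrix.diagonal (fun i => (l a i : ℂ)) := by
      refine Eq.trans ?_ h1
      congr 1
      exact star_star _
    rw [gaugeAct_mul, momentMap_gaugeAct_unitary hk, ← h2, Matrix.mul_add, Matrix.add_mul,
      Matrix.mul_smul, Matrix.mul_one, Matrix.smul_mul, hk', add_sub_cancel_right]
  have hmin : IsLocalMin (fun t : ℝ => diagKempfNess τ (gaugeAct (k * g) M) (t • l)) 0 := by
    refine Filter.Eventually.of_forall fun t => ?_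
    have h1 := kempfNess_expDiag_mul τ M ((0 : ℝ) • l) (k * g)
    have h2 := kempfNess_expDiag_mul τ M (t • l) (k * g)
    have h3 : (fun a => expDiag (((0 : ℝ) • l) a)) = 1 := by
      funext a
      ext i j
      simp [expDiag]
    rw [h3, one_mul, kempfNess_unitary_mul τ M hk] at h1
    have h4 := hg ((fun a => expDiag ((t • l) a)) * (k * g))
    linarith
  have hzero := hmin.hasDerivAt_eq_zero (hasDerivAt_diagKempfNess τ _ l)
  have hsum := sum_mul_momentMap_diag (gaugeAct (k * g) M) l
  have hsq : ∑ a, ∑ i, l a i * l a i = 0 := by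
    have h1 : ∑ a, ∑ i, (l a i : ℂ) * momentMap (gaugeAct (k * g) M) a i i =
        ((∑ a, ∑ i, l a i * l a i - ∑ a, τ a * ∑ i, l a i : ℝ) : ℂ) := by
      push_cast
      rw [← Finset.sum_sub_distrib]
      refine Finset.sum_congr rfl fun a _ => ?_
      rw [Finset.mul_sum, ← Finset.sum_sub_distrib]
      refine Finset.sum_congr rfl fun i _ => ?_
      rw [hdiag]
      simp
      ring
    rw [h1] at hsum
    have h2 := Complex.ofReal_injective hsum
    linarith
  refine ⟨k * g, fun a => ?_⟩
  have hl : ∀ i, l a i = 0 := by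
    intro i
    have h1 := (Finset.sum_eq_zero_iff_of_nonneg fun a _ => Finset.sum_nonneg fun i _ =>
      mul_self_nonneg (l a i)).1 hsq a (Finset.mem_univ _)
    have h2 := (Finset.sum_eq_zero_iff_of_nonneg fun i _ =>
      mul_self_nonneg (l a i)).1 h1 i (Finset.mem_univ _)
    exact mul_self_eq_zero.1 h2
  rw [hdiag]
  simp [hl]

end KempfNess

end

/-! ### Coercivity and existence of a minimum -/

section

open Module Matrix Topology

theorem Matrix.isCompact_unitaryGroup (n : Type*) [Fintype n] [DecidableEq n] :
    IsCompact (Matrix.unitaryGroup n ℂ : Set (Matrix n n ℂ)) := by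
  have hK : IsCompact (Set.pi Set.univ fun _ : n => Set.pi Set.univ fun _ : n =>
      Metric.closedBall (0 : ℂ) 1) :=
    isCompact_univ_pi fun _ => isCompact_univ_pi fun _ => isCompact_closedBall _ _
  refine IsCompact.of_isClosed_subset hK ?_ fun U hU i _ j _ => ?_
  · have : (Matrix.unitaryGroup n ℂ : Set (Matrix n n ℂ)) = {U | Uᴴ * U = 1} := by
      ext U
      exact Matrix.mem_unitaryGroup_iff'
    rw [this]
    exact isClosed_eq (by fun_prop) continuous_const
  · rw [mem_closedBall_zero_iff]
    exact entry_norm_bound_of_unitary hU i j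

section Coercivity

variable {Q : Type u} {ι : Q → Type w} [∀ a, Fintype (ι a)]

section WeightedSum

variable [Fintype Q]

theorem continuous_weightedSum (τ : Q → ℝ) :
    Continuous fun l : ∀ a, ι a → ℝ => ∑ a, τ a * ∑ i, l a i := by
  fun_prop

theorem weightedSum_smul (τ : Q → ℝ) (t : ℝ) (l : ∀ a, ι a → ℝ) :
    ∑ a, τ a * ∑ i, (t • l) a i = t * ∑ a, τ a * ∑ i, l a i := by
  simp only [Pi.smul_apply, smul_eq_mul, Finset.mul_sum]
  exact Finset.sum_congr rfl fun a _ => Finset.sum_congr rfl fun i _ => by ring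

end WeightedSum

variable [Quiver.{v} Q]

/-- The conjugate of a matrix representation by a family of unitary matrices. -/
def unitaryAct (U : ∀ a, Matrix (ι a) (ι a) ℂ) (M : ∀ a b : Q, (a ⟶ b) → Matrix (ι b) (ι a) ℂ)
    (a b : Q) (α : a ⟶ b) : Matrix (ι b) (ι a) ℂ :=
  U b * M a b α * (U a)ᴴ

theorem continuous_unitaryAct (M : ∀ a b : Q, (a ⟶ b) → Matrix (ι b) (ι a) ℂ) (a b : Q)
    (α : a ⟶ b) (i : ι b) (j : ι a) :
    Continuous fun U : ∀ a, Matrix (ι a) (ι a) ℂ => unitaryAct U M a b α i j := by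
  have h : Continuous fun U : ∀ a, Matrix (ι a) (ι a) ℂ => unitaryAct U M a b α := by
    unfold unitaryAct
    fun_prop
  exact h.matrix_elem i j

variable [Fintype Q]

variable [∀ a b : Q, Fintype (a ⟶ b)]

theorem continuous_diagKempfNess (τ : Q → ℝ) (M : ∀ a b : Q, (a ⟶ b) → Matrix (ι b) (ι a) ℂ) :
    Continuous fun p : (∀ a, Matrix (ι a) (ι a) ℂ) × (∀ a, ι a → ℝ) =>
      diagKempfNess τ (unitaryAct p.1 M) p.2 := by
  unfold diagKempfNess
  have h := continuous_unitaryAct M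
  refine Continuous.add ?_ (by fun_prop)
  refine continuous_finsetSum _ fun a _ => continuous_finsetSum _ fun b _ =>
    continuous_finsetSum _ fun α _ => continuous_finsetSum _ fun i _ =>
    continuous_finsetSum _ fun j _ => ?_
  have h1 := (h a b α i j).comp (continuous_fst (X := ∀ a, Matrix (ι a) (ι a) ℂ)
    (Y := ∀ a, ι a → ℝ))
  exact (h1.norm.pow 2).mul (by fun_prop)

theorem le_diagKempfNess (τ : Q → ℝ) (M : ∀ a b : Q, (a ⟶ b) → Matrix (ι b) (ι a) ℂ)
    (l : ∀ a, ι a → ℝ) {a b : Q} (α : a ⟶ b) (i : ι b) (j : ι a) :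
    ‖M a b α i j‖ ^ 2 * Real.exp (2 * (l b i - l a j)) + 2 * ∑ a, τ a * ∑ i, l a i ≤
      diagKempfNess τ M l := by
  unfold diagKempfNess
  gcongr
  refine le_trans ?_ (Finset.single_le_sum (fun _ _ => by positivity) (Finset.mem_univ a))
  refine le_trans ?_ (Finset.single_le_sum (fun _ _ => by positivity) (Finset.mem_univ b))
  refine le_trans ?_ (Finset.single_le_sum (fun _ _ => by positivity) (Finset.mem_univ α))
  refine le_trans ?_ (Finset.single_le_sum (fun _ _ => by positivity) (Finset.mem_univ i))
  exact Finset.single_le_sum (f := fun j => ‖M a b α i j‖ ^ 2 * Real.exp (2 * (l b i - l a j)))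
    (fun _ _ => by positivity) (Finset.mem_univ j)

theorem two_mul_sum_le_diagKempfNess (τ : Q → ℝ)
    (M : ∀ a b : Q, (a ⟶ b) → Matrix (ι b) (ι a) ℂ) (l : ∀ a, ι a → ℝ) :
    2 * ∑ a, τ a * ∑ i, l a i ≤ diagKempfNess τ M l := by
  unfold diagKempfNess
  have : 0 ≤ ∑ a, ∑ b, ∑ α : a ⟶ b, ∑ i, ∑ j,
      ‖M a b α i j‖ ^ 2 * Real.exp (2 * (l b i - l a j)) := by positivity
  linarith

theorem exists_forall_lt_mul_exp_sub {ε δ : ℝ} (hε : 0 < ε) (hδ : 0 < δ) (B C : ℝ) :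
    ∃ T : ℝ, 0 ≤ T ∧ ∀ t, T ≤ t → C < ε * Real.exp (2 * (t * δ)) - 2 * (t * B) := by
  -- The bound `exp x ≥ x² / 2` leaves `2 ε δ² t²`, which from this threshold on is at least `t (|C|
  -- + 1 + 2 |B|)`; `t ≥ 1` then takes care of the constant.
  refine ⟨max 1 ((|C| + 1 + 2 * |B|) / (2 * ε * δ ^ 2)), by positivity, fun t ht => ?_⟩
  have h1 : 1 ≤ t := (le_max_left _ _).trans ht
  have h2 := (le_max_right _ _).trans ht
  rw [div_le_iff₀ (by positivity)] at h2
  have h3 := Real.quadratic_le_exp_of_nonneg (x := 2 * (t * δ)) (by positivity)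
  have h4 : ε * (2 * t ^ 2 * δ ^ 2) ≤ ε * Real.exp (2 * (t * δ)) := by
    gcongr
    have : 0 ≤ 2 * (t * δ) := by positivity
    nlinarith
  have h5 : t * (|C| + 1 + 2 * |B|) ≤ t * (t * (2 * ε * δ ^ 2)) := by gcongr
  have h6 : t * B ≤ t * |B| := by gcongr; exact le_abs_self B
  have h7 : |C| + 1 ≤ t * (|C| + 1) := le_mul_of_one_le_left (by positivity) h1
  have h8 := le_abs_self C
  nlinarith

/-- Either the linear term has positive slope in the direction `l`, or some nonzero entry has a
growing exponential, which beats any linear term. Both are strict conditions, so one threshold `T`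
serves a whole neighbourhood of `(U, l)`. -/
theorem diagKempfNess_eventually_large {τ : Q → ℝ}
    {M : ∀ a b : Q, (a ⟶ b) → Matrix (ι b) (ι a) ℂ} {U : ∀ a, Matrix (ι a) (ι a) ℂ}
    {l : ∀ a, ι a → ℝ}
    (h : (∀ (a b : Q) (α : a ⟶ b) (i : ι b) (j : ι a), unitaryAct U M a b α i j ≠ 0 →
      l b i ≤ l a j) → 0 < ∑ a, τ a * ∑ i, l a i) (C : ℝ) :
    ∃ s ∈ 𝓝 (U, l), ∃ T : ℝ, ∀ t, T ≤ t → ∀ p ∈ s,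
      C < diagKempfNess τ (unitaryAct p.1 M) (t • p.2) := by
  have hw : Continuous fun p : (∀ a, Matrix (ι a) (ι a) ℂ) × (∀ a, ι a → ℝ) =>
      ∑ a, τ a * ∑ i, p.2 a i := (continuous_weightedSum τ).comp continuous_snd
  by_cases hs : 0 < ∑ a, τ a * ∑ i, l a i
  · set δ := (∑ a, τ a * ∑ i, l a i) / 2 with hδ
    have hδ0 : 0 < δ := by positivity
    refine ⟨_, (isOpen_lt continuous_const hw).mem_nhds (show δ < _ by simp only; linarith),
      max 1 ((|C| + 1) / δ), fun t ht p hp => ?_⟩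
    refine lt_of_lt_of_le ?_ (two_mul_sum_le_diagKempfNess τ _ _)
    rw [weightedSum_smul]
    have hp' : δ < ∑ a, τ a * ∑ i, p.2 a i := hp
    have h1 : 1 ≤ t := (le_max_left _ _).trans ht
    have h2 := (le_max_right _ _).trans ht
    rw [div_le_iff₀ hδ0] at h2
    have h3 : t * δ ≤ t * ∑ a, τ a * ∑ i, p.2 a i := by gcongr
    have h4 := le_abs_self C
    have h5 := abs_nonneg C
    linarith
  · have h' := mt h hs
    push Not at h'
    obtain ⟨a, b, α, i, j, hne, hlt⟩ := h'
    set ε := ‖unitaryAct U M a b α i j‖ ^ 2 / 2 with hε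
    have hε0 : 0 < ε := by positivity
    set δ := (l b i - l a j) / 2 with hδ
    have hδ0 : 0 < δ := by linarith
    -- The added `1` puts `-B` strictly below the linear slope at `l`, so that it stays below
    -- nearby.
    set B := -(∑ a, τ a * ∑ i, l a i) + 1 with hB
    obtain ⟨T, hT0, hT⟩ := exists_forall_lt_mul_exp_sub hε0 hδ0 B C
    have c1 : Continuous fun p : (∀ a, Matrix (ι a) (ι a) ℂ) × (∀ a, ι a → ℝ) =>
        ‖unitaryAct p.1 M a b α i j‖ ^ 2 := by
      have h1 := (continuous_unitaryAct M a b α i j).comp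
        (continuous_fst (X := ∀ a, Matrix (ι a) (ι a) ℂ) (Y := ∀ a, ι a → ℝ))
      exact h1.norm.pow 2
    have c2 : Continuous fun p : (∀ a, Matrix (ι a) (ι a) ℂ) × (∀ a, ι a → ℝ) =>
        p.2 b i - p.2 a j := by fun_prop
    have m1 := (c1.tendsto (U, l)).eventually_const_lt (u := ε) (by simp only; linarith)
    have m2 := (c2.tendsto (U, l)).eventually_const_lt (u := δ) (by simp only; linarith)
    have m3 := (hw.tendsto (U, l)).eventually_const_lt (u := -B) (by simp only; linarith)
    refine ⟨_, m1.and (m2.and m3), T, fun t ht p ⟨h1, h2, h3⟩ => ?_⟩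
    refine lt_of_lt_of_le (hT t ht) (le_trans ?_ (le_diagKempfNess τ _ _ α i j))
    rw [weightedSum_smul]
    have ht0 : 0 ≤ t := hT0.trans ht
    have e1 : ε * Real.exp (2 * (t * δ)) ≤ ‖unitaryAct p.1 M a b α i j‖ ^ 2 *
        Real.exp (2 * ((t • p.2) b i - (t • p.2) a j)) := by
      have : (t • p.2) b i - (t • p.2) a j = t * (p.2 b i - p.2 a j) := by
        simp only [Pi.smul_apply, smul_eq_mul]
        ring
      rw [this]
      gcongr
    have e2 : t * (-B) ≤ t * ∑ a, τ a * ∑ i, p.2 a i := by gcongr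
    linarith

/-- A common scalar at all vertices acts trivially on the matrices, and `hτ` cancels its effect on
the linear term. This allows normalising to directions of total sum `0`. -/
theorem diagKempfNess_add_const {τ : Q → ℝ} (hτ : ∑ a, τ a * (Fintype.card (ι a) : ℝ) = 0)
    (M : ∀ a b : Q, (a ⟶ b) → Matrix (ι b) (ι a) ℂ) (l : ∀ a, ι a → ℝ) (c : ℝ) :
    diagKempfNess τ M (fun a i => l a i + c) = diagKempfNess τ M l := by
  unfold diagKempfNess
  have h1 : ∑ a, τ a * ∑ i, (l a i + c) = ∑ a, τ a * ∑ i, l a i := by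
    simp only [Finset.sum_add_distrib, mul_add, Finset.sum_const, Finset.card_univ, nsmul_eq_mul]
    simp only [← mul_assoc, ← Finset.sum_mul, hτ, zero_mul, add_zero]
  simp only [h1, add_sub_add_right_eq_sub]

variable [∀ a, DecidableEq (ι a)]

/-- Unitary families times unit directions of sum `0` form a compact set, so the local thresholds
combine into one. Beyond that radius the functional exceeds its value at `(1, 0)`, and a minimum
over the compact ball is a global one. -/
theorem exists_diagKempfNess_min {τ : Q → ℝ} {M : ∀ a b : Q, (a ⟶ b) → Matrix (ι b) (ι a) ℂ}
    (h : ∀ U : ∀ a, Matrix (ι a) (ι a) ℂ, (∀ a, U a ∈ Matrix.unitaryGroup (ι a) ℂ) →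
      ∀ l : ∀ a, ι a → ℝ, ∑ a, ∑ i, l a i = 0 → l ≠ 0 →
      (∀ (a b : Q) (α : a ⟶ b) (i : ι b) (j : ι a), unitaryAct U M a b α i j ≠ 0 →
        l b i ≤ l a j) → 0 < ∑ a, τ a * ∑ i, l a i) :
    ∃ U : ∀ a, Matrix (ι a) (ι a) ℂ, (∀ a, U a ∈ Matrix.unitaryGroup (ι a) ℂ) ∧
      ∃ l : ∀ a, ι a → ℝ, ∀ U' : ∀ a, Matrix (ι a) (ι a) ℂ,
        (∀ a, U' a ∈ Matrix.unitaryGroup (ι a) ℂ) → ∀ l' : ∀ a, ι a → ℝ, ∑ a, ∑ i, l' a i = 0 →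
          diagKempfNess τ (unitaryAct U M) l ≤ diagKempfNess τ (unitaryAct U' M) l' := by
  let K : Set (∀ a, Matrix (ι a) (ι a) ℂ) :=
    Set.pi Set.univ fun a => (Matrix.unitaryGroup (ι a) ℂ : Set (Matrix (ι a) (ι a) ℂ))
  have hK : IsCompact K := isCompact_univ_pi fun a => Matrix.isCompact_unitaryGroup (ι a)
  have hmem : ∀ U, U ∈ K ↔ ∀ a, U a ∈ Matrix.unitaryGroup (ι a) ℂ := fun U => by simp [K]
  let Z : Set (∀ a, ι a → ℝ) := {l | ∑ a, ∑ i, l a i = 0}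
  have hZ : IsClosed Z := isClosed_eq (by fun_prop) continuous_const
  let F : (∀ a, Matrix (ι a) (ι a) ℂ) × (∀ a, ι a → ℝ) → ℝ :=
    fun p => diagKempfNess τ (unitaryAct p.1 M) p.2
  have hF : Continuous F := continuous_diagKempfNess τ M
  let p₀ : (∀ a, Matrix (ι a) (ι a) ℂ) × (∀ a, ι a → ℝ) := (1, 0)
  have hp₀ : (1 : ∀ a, Matrix (ι a) (ι a) ℂ) ∈ K := (hmem _).2 fun a => one_mem _
  have hS : IsCompact (K ×ˢ (Metric.sphere (0 : ∀ a, ι a → ℝ) 1 ∩ Z)) :=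
    hK.prod ((isCompact_sphere _ _).inter_right hZ)
  obtain ⟨T, hT⟩ : ∃ T : ℝ, ∀ t, T ≤ t → ∀ p ∈ K ×ˢ (Metric.sphere (0 : ∀ a, ι a → ℝ) 1 ∩ Z),
      F p₀ < diagKempfNess τ (unitaryAct p.1 M) (t • p.2) := by
    refine hS.induction_on (p := fun s => ∃ T : ℝ, ∀ t, T ≤ t → ∀ p ∈ s,
      F p₀ < diagKempfNess τ (unitaryAct p.1 M) (t • p.2)) ⟨0, by simp⟩ ?_ ?_ ?_
    · rintro s s' hss ⟨T, hT⟩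
      exact ⟨T, fun t ht p hp => hT t ht p (hss hp)⟩
    · rintro s s' ⟨T, hT⟩ ⟨T', hT'⟩
      refine ⟨max T T', fun t ht p hp => hp.elim (hT t ((le_max_left _ _).trans ht) p)
        (hT' t ((le_max_right _ _).trans ht) p)⟩
    · rintro ⟨U, l⟩ ⟨hU, hl, hlZ⟩
      obtain ⟨s, hs, hs'⟩ := diagKempfNess_eventually_large (h U ((hmem U).1 hU) l hlZ
        (fun h0 => by simp [h0] at hl)) (F p₀)
      exact ⟨s, mem_nhdsWithin_of_mem_nhds hs, hs'⟩
  let R : ℝ := max T 1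
  have hD : IsCompact (K ×ˢ (Metric.closedBall (0 : ∀ a, ι a → ℝ) R ∩ Z)) :=
    hK.prod ((isCompact_closedBall _ _).inter_right hZ)
  have hp₀D : p₀ ∈ K ×ˢ (Metric.closedBall (0 : ∀ a, ι a → ℝ) R ∩ Z) :=
    ⟨hp₀, by simp [p₀, R], by simp [p₀, Z]⟩
  obtain ⟨⟨U, l⟩, hp, hmin⟩ := hD.exists_isMinOn ⟨p₀, hp₀D⟩ hF.continuousOn
  refine ⟨U, (hmem U).1 hp.1, l, fun U' hU' l' hl' => ?_⟩
  by_cases hb : ‖l'‖ ≤ R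
  · exact isMinOn_iff.1 hmin (U', l') ⟨(hmem U').2 hU', by simpa using hb, hl'⟩
  · have h1 : R < ‖l'‖ := not_le.1 hb
    have h0 : 0 < ‖l'‖ := (zero_lt_one.trans_le (le_max_right _ _)).trans h1
    have h2 := hT ‖l'‖ ((le_max_left _ _).trans h1.le) (U', ‖l'‖⁻¹ • l')
      ⟨(hmem U').2 hU', by simp [norm_smul, h0.ne'], by
        have : ∑ a, ∑ i, (‖l'‖⁻¹ • l') a i = ‖l'‖⁻¹ * ∑ a, ∑ i, l' a i := by
          simp only [Pi.smul_apply, smul_eq_mul, Finset.mul_sum]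
        change ∑ a, ∑ i, (‖l'‖⁻¹ • l') a i = 0
        rw [this, hl', mul_zero]⟩
    simp only [smul_smul, mul_inv_cancel₀ h0.ne', one_smul] at h2
    exact (isMinOn_iff.1 hmin p₀ hp₀D).trans h2.le

/-- The decomposition `g' = k · exp(l') · V` reduces any competitor to a pair `(V, l')`, since the
unitary factor `k` on the left does not change the functional. -/
theorem exists_kempfNess_min {τ : Q → ℝ} {M : ∀ a b : Q, (a ⟶ b) → Matrix (ι b) (ι a) ℂ}
    (hτ : ∑ a, τ a * (Fintype.card (ι a) : ℝ) = 0)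
    (h : ∀ U : ∀ a, Matrix (ι a) (ι a) ℂ, (∀ a, U a ∈ Matrix.unitaryGroup (ι a) ℂ) →
      ∀ l : ∀ a, ι a → ℝ, ∑ a, ∑ i, l a i = 0 → l ≠ 0 →
      (∀ (a b : Q) (α : a ⟶ b) (i : ι b) (j : ι a), unitaryAct U M a b α i j ≠ 0 →
        l b i ≤ l a j) → 0 < ∑ a, τ a * ∑ i, l a i) :
    ∃ g : ∀ a, (Matrix (ι a) (ι a) ℂ)ˣ, ∀ g', kempfNess τ M g ≤ kempfNess τ M g' := by
  have hval : ∀ (U : ∀ a, Matrix.unitaryGroup (ι a) ℂ) (l : ∀ a, ι a → ℝ),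
      kempfNess τ M ((fun a => expDiag (l a)) * fun a => Unitary.toUnits (U a)) =
        diagKempfNess τ (unitaryAct (fun a => (U a).val) M) l := by
    intro U l
    have h1 : gaugeAct (fun a => Unitary.toUnits (U a)) M = unitaryAct (fun a => (U a).val) M := rfl
    have h2 : ∀ a, ‖(Unitary.toUnits (U a)).val.det‖ = 1 := fun a =>
      Matrix.norm_det_eq_one_of_unitary (Unitary.star_mul_self_of_mem (U a).2)
    rw [kempfNess_expDiag_mul, h1]
    simp [Matrix.norm_det_eq_one_of_unitary (Unitary.star_mul_self_of_mem (U _).2)]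
  obtain ⟨U, hU, l, hmin⟩ := exists_diagKempfNess_min h
  refine ⟨(fun a => expDiag (l a)) * fun a => Unitary.toUnits ⟨U a, hU a⟩, fun g' => ?_⟩
  choose k V l' hk hV hg using fun a => Matrix.exists_unitary_expDiag_unitary (g' a)
  choose V' hV' using hV
  have hg' : g' = k * ((fun a => expDiag (l' a)) * fun a => Unitary.toUnits (V' a)) := by
    funext a
    rw [hg a, ← hV' a]
    rfl
  rw [hg', kempfNess_unitary_mul τ M hk, hval, hval]
  set N : ℝ := ∑ a, (Fintype.card (ι a) : ℝ) with hN
  -- Minus the mean of `l'`, so that `l' + c` has sum `0`; if `N = 0` all index sets are empty and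
  -- the sum is trivially `0`.
  set c : ℝ := -(∑ a, ∑ i, l' a i) / N with hc
  rw [← diagKempfNess_add_const hτ _ l' c]
  refine hmin _ (fun a => (V' a).2) _ ?_
  have hsum : ∑ a, ∑ i, (l' a i + c) = (∑ a, ∑ i, l' a i) + N * c := by
    simp only [Finset.sum_add_distrib, Finset.sum_const, Finset.card_univ, nsmul_eq_mul, hN,
      Finset.sum_mul]
  rw [hsum]
  by_cases hN0 : N = 0
  · have h1 : ∀ a, IsEmpty (ι a) := by
      intro a
      have := (Finset.sum_eq_zero_iff_of_nonneg fun a _ => Nat.cast_nonneg _).1 (hN ▸ hN0) a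
        (Finset.mem_univ _)
      exact Fintype.card_eq_zero_iff.1 (by exact_mod_cast this)
    simp [hN0]
  · rw [hc]
    field_simp
    ring

end Coercivity

end

/-! ### Harmonic metrics on stable and polystable representations -/

section

open Module Matrix

theorem Module.Basis.exists_repr_eq_mulVec {n : Type*} [Fintype n] [DecidableEq n] {E : Type*}
    [AddCommGroup E] [Module ℂ E] (b : Basis n ℂ E) (g : (Matrix n n ℂ)ˣ) :
    ∃ b' : Basis n ℂ E, ∀ x, (b'.repr x : n → ℂ) = g.val *ᵥ (b.repr x) := by
  let e : (n → ℂ) ≃ₗ[ℂ] (n → ℂ) := LinearEquiv.ofLinearMap g.val.mulVecLin g⁻¹.val.mulVecLin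
    (by rw [← Matrix.mulVecLin_mul, Units.mul_inv, Matrix.mulVecLin_one])
    (by rw [← Matrix.mulVecLin_mul, Units.inv_mul, Matrix.mulVecLin_one])
  refine ⟨Basis.ofEquivFun (b.equivFun.trans e), fun x => ?_⟩
  rw [← Basis.equivFun_apply, Basis.equivFun_ofEquivFun]
  rfl

namespace QuiverRep

section Gauge

variable {Q : Type u} [Quiver.{v} Q] (V : QuiverRep.{u, v, w, 0} ℂ Q) {ι : Q → Type w'}
  [∀ a, Fintype (ι a)] [∀ a, DecidableEq (ι a)]

theorem mat_mulVec_repr (b : ∀ a, Basis (ι a) ℂ (V.space a)) {a c : Q} (α : a ⟶ c)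
    (x : V.space a) : V.mat b a c α *ᵥ ((b a).repr x) = (b c).repr (V.map α x) :=
  LinearMap.toMatrix_mulVec_repr (b a) (b c) (V.map α) x

/-- Points of the gauge orbit are the matrices of the same representation in other bases, so a gauge
solution of the moment map equation is a harmonic metric. -/
theorem exists_mat_eq_gaugeAct (b : ∀ a, Basis (ι a) ℂ (V.space a))
    (g : ∀ a, (Matrix (ι a) (ι a) ℂ)ˣ) :
    ∃ b' : ∀ a, Basis (ι a) ℂ (V.space a), V.mat b' = gaugeAct g (V.mat b) := by
  choose b' hb' using fun a => (b a).exists_repr_eq_mulVec (g a)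
  refine ⟨b', ?_⟩
  funext a c α
  refine Matrix.ext_of_mulVec_single fun j => ?_
  have h1 : Pi.single j (1 : ℂ) = ((b' a).repr (b' a j) : ι a → ℂ) := by
    rw [Basis.repr_self, Finsupp.single_eq_pi_single]
  rw [h1, mat_mulVec_repr, hb', ← mat_mulVec_repr, hb', gaugeAct, Matrix.mulVec_mulVec,
    Matrix.mulVec_mulVec, Matrix.mul_assoc _ _ (g a).val, Units.inv_mul, Matrix.mul_one]

variable {V} in
/-- The subrepresentation spanned by the basis vectors of bounded weight. -/
def Subrep.sublevel (b : ∀ a, Basis (ι a) ℂ (V.space a)) (l : ∀ a, ι a → ℝ)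
    (h : ∀ (a c : Q) (α : a ⟶ c) (i : ι c) (j : ι a), V.mat b a c α i j ≠ 0 → l c i ≤ l a j)
    (r : ℝ) : V.Subrep where
  carrier a := Submodule.span ℂ (Set.range fun i : {i : ι a // l a i ≤ r} => b a i)
  map_mem {a c} α y hy := by
    refine (Submodule.span_le (p := (Submodule.span ℂ (Set.range
      fun i : {i : ι c // l c i ≤ r} => b c i)).comap (V.map α))).2 ?_ hy
    rintro _ ⟨⟨j, hj⟩, rfl⟩
    change V.map α (b a j) ∈
      Submodule.span ℂ (Set.range fun i : {i : ι c // l c i ≤ r} => b c i)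
    rw [← (b c).sum_repr (V.map α (b a j))]
    refine Submodule.sum_mem _ fun i _ => ?_
    have h1 : (b c).repr (V.map α (b a j)) i = V.mat b a c α i j :=
      (LinearMap.toMatrix_apply _ _ _ _ _).symm
    rw [h1]
    by_cases h0 : V.mat b a c α i j = 0
    · rw [h0, zero_smul]
      exact Submodule.zero_mem _
    · exact Submodule.smul_mem _ _ (Submodule.subset_span ⟨⟨i, (h a c α i j h0).trans hj⟩, rfl⟩)

variable {V} in
theorem Subrep.finrank_sublevel (b : ∀ a, Basis (ι a) ℂ (V.space a)) (l : ∀ a, ι a → ℝ)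
    (h : ∀ (a c : Q) (α : a ⟶ c) (i : ι c) (j : ι a), V.mat b a c α i j ≠ 0 → l c i ≤ l a j)
    (r : ℝ) (a : Q) :
    finrank ℂ ((Subrep.sublevel b l h r).carrier a) = Fintype.card {i : ι a // l a i ≤ r} :=
  finrank_span_eq_card ((b a).linearIndependent.comp _ Subtype.val_injective)

end Gauge

section Stable

variable {Q : Type u} [Quiver.{v} Q] [Fintype Q] {V : QuiverRep.{u, v, w, 0} ℂ Q}
  {ι : Q → Type w'} [∀ a, Fintype (ι a)] [∀ a, DecidableEq (ι a)]

/-- Under `h`, arrows never raise the weight `l`, so basis vectors of weight at most `r` span a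
subrepresentation. When nonzero and proper it has negative shifted degree by stability, and Abel
summation over `r` gives positivity. A nonzero `l` of sum `0` is not constant. -/
theorem IsStable.sum_weight_pos {θ : Q → ℝ} (hV : V.IsStable θ)
    (b : ∀ a, Basis (ι a) ℂ (V.space a)) {l : ∀ a, ι a → ℝ}
    (h : ∀ (a c : Q) (α : a ⟶ c) (i : ι c) (j : ι a), V.mat b a c α i j ≠ 0 → l c i ≤ l a j)
    (hl : ∑ a, ∑ i, l a i = 0) (hl0 : l ≠ 0) :
    0 < ∑ a, (θ a - V.slope θ) * ∑ i, l a i := by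
  have hdeg : V.degree (fun a => θ a - V.slope θ) = 0 := (slope_eq_iff θ _ hV.1).1 rfl
  have key := sum_mul_pos_of_sum_sublevel_neg (J := Σ a, ι a) (fun p => θ p.1 - V.slope θ)
    (fun p => l p.1 p.2) ?_ ?_ ?_
  · rw [Fintype.sum_sigma] at key
    simpa only [Finset.mul_sum] using key
  · rw [Fintype.sum_sigma]
    simp only [Finset.sum_const, Finset.card_univ, nsmul_eq_mul]
    rw [← hdeg, degree]
    refine Finset.sum_congr rfl fun a _ => ?_
    rw [finrank_eq_card_basis (b a), mul_comm]
  · rintro r ⟨⟨a, i⟩, hi⟩ ⟨⟨c, j⟩, hj⟩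
    let S := Subrep.sublevel b l h r
    have hfin : ∀ a, finrank ℂ (S.carrier a) = Fintype.card {i : ι a // l a i ≤ r} :=
      Subrep.finrank_sublevel b l h r
    have hS0 : S.toRep.IsNonzero := by
      refine ⟨a, ?_⟩
      have : 0 < finrank ℂ (S.carrier a) := by
        rw [hfin, Fintype.card_pos_iff]
        exact ⟨⟨i, hi⟩⟩
      have hn : Nontrivial (S.carrier a) := Module.nontrivial_of_finrank_pos this
      exact hn
    have hSp : S.IsProper := by
      refine ⟨c, fun htop => ?_⟩
      have h1 := hfin c
      rw [htop, finrank_top, finrank_eq_card_basis (b c)] at h1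
      have h2 : Fintype.card {i : ι c // l c i ≤ r} < Fintype.card (ι c) :=
        Fintype.card_subtype_lt (x := j) (not_le.2 hj)
      omega
    have h1 := (slope_lt_iff θ _ hS0).1 (hV.2 S hS0 hSp)
    rw [S.degree_toRep, Subrep.deg] at h1
    refine lt_of_eq_of_lt ?_ h1
    rw [Finset.sum_filter, Fintype.sum_sigma]
    refine Finset.sum_congr rfl fun a _ => ?_
    rw [hfin, Fintype.card_subtype, ← Finset.sum_filter]
    dsimp only
    rw [Finset.sum_const, nsmul_eq_mul, mul_comm]
  · by_contra hcon
    push Not at hcon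
    apply hl0
    funext a i
    have hconst : ∀ p : Σ a, ι a, l p.1 p.2 = l a i := fun p =>
      le_antisymm (hcon ⟨a, i⟩ p) (hcon p ⟨a, i⟩)
    have h1 : ∑ p : Σ a, ι a, l p.1 p.2 = 0 := by rw [Fintype.sum_sigma]; exact hl
    rw [Finset.sum_congr rfl fun p _ => hconst p, Finset.sum_const, nsmul_eq_mul] at h1
    have hne : ((Finset.univ : Finset (Σ a, ι a)).card : ℝ) ≠ 0 := by
      rw [Nat.cast_ne_zero]
      exact Finset.card_ne_zero_of_mem (Finset.mem_univ ⟨a, i⟩)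
    exact (mul_eq_zero.1 h1).resolve_left hne

/-- `IsStable.sum_weight_pos`, applied in every unitary change of the chosen bases, is the
coercivity hypothesis for a Kempf–Ness minimum. -/
theorem IsStable.hasHarmonicMetric [∀ a b : Q, Fintype (a ⟶ b)] {θ : Q → ℝ}
    (hV : V.IsStable θ) : V.HasHarmonicMetric fun a => θ a - V.slope θ := by
  let b : ∀ a, Basis (Fin (finrank ℂ (V.space a))) ℂ (V.space a) := fun a => finBasis ℂ _
  have hdeg : V.degree (fun a => θ a - V.slope θ) = 0 := (slope_eq_iff θ _ hV.1).1 rfl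
  obtain ⟨g, hg⟩ := exists_kempfNess_min (τ := fun a => θ a - V.slope θ) (M := V.mat b)
    (by simpa [degree] using hdeg) (by
      intro U hU l hl hl0 h
      obtain ⟨b', hb'⟩ := V.exists_mat_eq_gaugeAct b fun a => Unitary.toUnits ⟨U a, hU a⟩
      have h1 : V.mat b' = unitaryAct U (V.mat b) := hb'
      exact hV.sum_weight_pos b' (by rw [h1]; exact h) hl hl0)
  obtain ⟨g', hg'⟩ := exists_momentMap_eq_of_isMin hg
  obtain ⟨b', hb'⟩ := V.exists_mat_eq_gaugeAct b g'
  exact ⟨_, inferInstance, inferInstance, b', by rw [hb']; exact hg'⟩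

theorem IsPolystable.hasHarmonicMetric [∀ a b : Q, Fintype (a ⟶ b)] {θ : Q → ℝ}
    (hV : V.IsPolystable θ) : V.HasHarmonicMetric fun a => θ a - V.slope θ := by
  obtain ⟨-, n, R, hR, ⟨f⟩⟩ := hV
  refine HasHarmonicMetric.of_iso f (HasHarmonicMetric.directSum fun i => ?_)
  -- The summands share the slope of `V`, hence the same shifted weight.
  rw [← (hR i).2]
  exact (hR i).1.hasHarmonicMetric

end Stable

theorem IsNonzero.tensor {k : Type x} [Field k] {Q : Type u} [Quiver.{v} Q] {Q' : Type u'}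
    [Quiver.{v'} Q'] {V : QuiverRep.{u, v, w, x} k Q} {W : QuiverRep.{u', v', w', x} k Q'}
    (hV : V.IsNonzero) (hW : W.IsNonzero) : (V.tensor W).IsNonzero := by
  obtain ⟨a, ha⟩ := hV
  obtain ⟨c, hc⟩ := hW
  refine ⟨(a, c), ?_⟩
  change Nontrivial (V.space a ⊗[k] W.space c)
  apply Module.nontrivial_of_finrank_pos (R := k)
  rw [finrank_tensorProduct]
  exact Nat.mul_pos (finrank_pos_iff.2 ha) (finrank_pos_iff.2 hc)

end QuiverRep

end

end

theorem lemma2p1 {Q : Type*} [Quiver Q] [Fintype Q] [∀ a b : Q, Finite (a ⟶ b)]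
    {Q' : Type*} [Quiver Q'] [Fintype Q'] [∀ a b : Q', Finite (a ⟶ b)]
    (θ : Q → ℝ) (hθ : IsRationalWeight θ) (θ' : Q' → ℝ) (hθ' : IsRationalWeight θ')
    (V : QuiverRep ℂ Q) (W : QuiverRep ℂ Q')
    (hV : V.IsPolystable θ) (hW : W.IsPolystable θ') :
    (V.tensor W).IsPolystable (sumWeight θ θ') := by
  have (a b : Q) : Fintype (a ⟶ b) := Fintype.ofFinite _
  have (a b : Q') : Fintype (a ⟶ b) := Fintype.ofFinite _
  have (p q : InternalProduct Q Q') : Finite (p ⟶ q) :=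
    Finite.of_injective (fun γ => QuiverRep.arrowsInEquiv q ⟨p, γ⟩) fun γ γ' h => by
      simpa using (QuiverRep.arrowsInEquiv q).injective h
  have (p q : InternalProduct Q Q') : Fintype (p ⟶ q) := Fintype.ofFinite _
  have h := hV.hasHarmonicMetric.tensor hW.hasHarmonicMetric
  -- The shifts add up, so the tensor metric is harmonic with constant `c = μ_θ(V) + μ_θ'(W)`, which
  -- is thereby the slope of the tensor product.
  have hw : sumWeight (fun a => θ a - V.slope θ) (fun c => θ' c - W.slope θ') =
      fun p => sumWeight θ θ' p - (V.slope θ + W.slope θ') := by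
    funext p
    simp only [sumWeight]
    ring
  rw [hw] at h
  exact h.isPolystable (hV.1.1.tensor hW.1.1)
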